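/- \textbf{Setting.} Fix $p\ge 1$. For each sample size $n$ let $y=X\beta+\varepsilon\in\mathbb R^n$, where $X\in\mathbb R^{n\times p}$ is non-random and (for all large $n$) of full column rank, $\beta\in\mathbb R^p$ is unknown, and the components of $\varepsilon$ are independent and identically distributed, with a common law that does not depend on $n$ and has mean zero and finite second moment; $P_\beta$ denotes probability when the true parameter is $\beta$. Assume that $X'X/n\to C$ for a positive definite matrix $C$. Let $\hat\beta_{LS}=(X'X)^{-1}X'y$ and assume that, for all large $n$, $P_\beta(\hat\beta_{LS,j}=0)=0$ for every $j$ and every $\beta\in\mathbb R^p$. For tuning parameters $\lambda_j=\lambda_{n,j}\ge 0$ let $\hat\beta_{AL}$ be the adaptive Lasso estimator, that is, the minimizer over $b\in\mathbb R^p$ of $$\|y-Xb\|^2+2\sum_{j=1}^p\lambda_j\frac{|b_j|}{|\hat\beta_{LS,j}|}.$$ Let $\lambda^*=\max_j\lambda_j$, and assume that for every $j$ the limits $\lambda_j/\lambda^*\to\lambda^0_j\in[0,1]$ and $\sqrt{\lambda^*}/\lambda_j\to\psi_j\in[0,\infty]$ exist as $n\to\infty$ (with $\sqrt{\lambda^*}/\lambda_j=\infty$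 if $\lambda_j=0<\lambda^*$). For $\mu\in[0,\infty)^p$ put $$\mathcal M(\mu,\psi)=\{m\in\mathbb R^p:\ (Cm)_j=0 \text{ if } \psi_j=\infty,\ \ m_j(Cm)_j\le\mu_j \text{ if } \psi_j<\infty\},$$ and let $\mathcal M=\mathcal M(\lambda^0,\psi)$ and $\mathcal M_d=\mathcal M(d\lambda^0,\psi)$ for $d>0$. \textbf{Theorem (Confidence regions).} Let $\lambda^*/n\to0$ and $\lambda^*\to\infty$. Then every open set $O\supseteq\mathcal M$ satisfies $$\lim_{n\to\infty}\ \inf_{\beta\in\mathbb R^p}P_\beta\Big(\beta\in\hat\beta_{AL}-\sqrt{\lambda^*/n}\;O\Big)=1,$$ and for every $0<d<1$ $$\lim_{n\to\infty}\ \inf_{\beta\in\mathbb R^p}P_\beta\Big(\beta\in\hat\beta_{AL}-\sqrt{\lambda^*/n}\;\mathcal M_d\Big)=0.$$ -/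

import Mathlib

open Filter Topology MeasureTheory ProbabilityTheory Matrix
open scoped ENNReal

namespace AdaptiveLasso

noncomputable section

/-- The ordinary least-squares estimator `(X'X)⁻¹ X'y`. -/
def leastSquares {n p : ℕ} (X : Matrix (Fin n) (Fin p) ℝ) (y : Fin n → ℝ) : Fin p → ℝ :=
  (Xᵀ * X)⁻¹ *ᵥ (Xᵀ *ᵥ y)

/-- The adaptive Lasso objective: the squared Euclidean norm of the residual plus
`2 ∑ⱼ lamⱼ |bⱼ| / |β̂_LS,ⱼ|`. -/
def objective {n p : ℕ} (X : Matrix (Fin n) (Fin p) ℝ) (lam : Fin p → ℝ) (y : Fin n → ℝ)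
    (b : Fin p → ℝ) : ℝ :=
  ‖WithLp.toLp 2 (y - X *ᵥ b)‖ ^ 2 + 2 * ∑ j, lam j * (|b j| / |leastSquares X y j|)

/-- The adaptive Lasso estimator, the minimizer over `ℝᵖ` of the objective (the minimizer is
unique as soon as `X` has full column rank). -/
def estimator {n p : ℕ} (X : Matrix (Fin n) (Fin p) ℝ) (lam : Fin p → ℝ) (y : Fin n → ℝ) :
    Fin p → ℝ :=
  Classical.epsilon fun b => IsMinOn (objective X lam y) Set.univ b

/-- The response vector `y = Xβ + ε`, evaluated at an outcome `ω`. -/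
def response {Ω : Type*} {n p : ℕ} (X : Matrix (Fin n) (Fin p) ℝ) (ε : Fin n → Ω → ℝ)
    (β : Fin p → ℝ) (ω : Ω) : Fin n → ℝ :=
  X *ᵥ β + fun i => ε i ω

/-- The largest tuning parameter. -/
def lamStar {p : ℕ} (lam : Fin p → ℝ) : ℝ := ⨆ j, lam j

/-- The set `M(lam0, ψ)` of all `m ∈ ℝᵖ` with `(Cm)ⱼ = 0` if `ψⱼ = ∞` and
`mⱼ (Cm)ⱼ ≤ lam0ⱼ` if `ψⱼ < ∞`. -/
def minimizerSet {p : ℕ} (C : Matrix (Fin p) (Fin p) ℝ) (lam0 : Fin p → ℝ)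
    (ψ : Fin p → ℝ≥0∞) : Set (Fin p → ℝ) :=
  {m | ∀ j, (ψ j = ∞ → (C *ᵥ m) j = 0) ∧ (ψ j < ∞ → m j * (C *ᵥ m) j ≤ lam0 j)}

/-- The region `β̂_AL - √(lam*/n) A` computed from the data `y`. -/
def region {n p : ℕ} (X : Matrix (Fin n) (Fin p) ℝ) (lam : Fin p → ℝ) (A : Set (Fin p → ℝ))
    (y : Fin n → ℝ) : Set (Fin p → ℝ) :=
  (fun a => estimator X lam y - Real.sqrt (lamStar lam / n) • a) '' A

/-- The coverage probability at the parameter `β`, that is, the probability that the region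
contains `β` when the response is `y = Xβ + ε`. -/
def coverage {Ω : Type*} [MeasurableSpace Ω] (P : Measure Ω) {n p : ℕ}
    (X : Matrix (Fin n) (Fin p) ℝ) (ε : Fin n → Ω → ℝ) (lam : Fin p → ℝ)
    (A : Set (Fin p → ℝ)) (β : Fin p → ℝ) : ℝ≥0∞ :=
  P {ω | β ∈ region X lam A (response X ε β ω)}

end

end AdaptiveLasso

/-!
The estimator is compared with least squares rather than with the true parameter. With
`r = √(lam*/n)`, `C_n = X'X/n` and `v = (β̂_AL - β̂_LS) / r`, the subgradient conditions give
`vⱼ (C_n v)ⱼ ≤ lamⱼ/lam*` and `|(C_n v)ⱼ| ≤ (lamⱼ/lam*) · r/|β̂_LS,ⱼ|` for every data vector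
(`scaled_subgradient`). The rescaled estimation error `(β̂_AL - β) / r` equals `v + e`, where
`e = (β̂_LS - β) / r` does not depend on `β` and tends to zero in probability because `lam* → ∞`.

For the first limit, the first inequality bounds `v` and passes to the limit set. If `ψⱼ = ∞`, then
`(C_n v)ⱼ` is small unless `√n |β̂_LS,ⱼ|` is below a null sequence, and this has probability tending
to zero uniformly in `β`. That is anti-concentration of `√n (β̂_LS,ⱼ - β)`, a weighted sum of the
errors whose squared weights sum to about `(C⁻¹)ⱼⱼ`. No Lindeberg condition is available for a
triangular array of regressors. Instead, the hypothesis on `β̂_LS` forces the error law to be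
atomless; a large weight then suffices by independence, and if all weights are small the
characteristic function decays like a Gaussian on a long interval
(`exists_measureReal_weightedSum_le`). A compactness argument along ultrafilters
(`exists_pos_eventually_mem_of_isOpen`) turns these facts into coverage of the open set.

For the second limit, take `j₀` with `lam0 j₀ = 1` and the parameter with `j₀`-th component `t r`,
where `t² = (C⁻¹)_{j₀j₀}`, all others being `1`. In the limit `C m` is supported at `j₀`, and the
complementarity relation `(C m)_{j₀} (t + m_{j₀}) = -|t + m_{j₀}|/t` forces
`m_{j₀} (C m)_{j₀} = 1 > d` (`exists_pos_eventually_notMem`), so the shrunken region misses the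
parameter with probability tending to one.
-/

namespace AdaptiveLasso

/-! ### Anti-concentration of weighted sums -/

/-- An atomless law gives uniformly small mass to short intervals, because `μ(B)²` is at most the
`μ ⊗ μ`-mass of a strip around the diagonal, which is a null set. -/
lemma exists_forall_measure_ball_le (μ : Measure ℝ) [IsProbabilityMeasure μ]
    (hμ : ∀ x, μ {x} = 0) {τ : ℝ} (hτ : 0 < τ) :
    ∃ δ > 0, ∀ x, μ.real (Metric.ball x δ) ≤ τ := by
  have hanti : Antitone fun k : ℕ => {q : ℝ × ℝ | dist q.1 q.2 ≤ 1 / (k + 1 : ℝ)} := by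
    intro k l hkl q hq
    simp only [Set.mem_ofPred_eq] at hq ⊢
    exact hq.trans
      (one_div_le_one_div_of_le (by positivity) (by exact_mod_cast Nat.succ_le_succ hkl))
  have hmeas : ∀ k : ℕ, MeasurableSet {q : ℝ × ℝ | dist q.1 q.2 ≤ 1 / (k + 1 : ℝ)} := fun k =>
    measurableSet_le (by fun_prop) measurable_const
  have hlim := tendsto_measure_iInter_atTop (μ := μ.prod μ)
    (fun k => (hmeas k).nullMeasurableSet) hanti ⟨0, measure_ne_top _ _⟩
  have hdiag : (μ.prod μ) (⋂ k : ℕ, {q : ℝ × ℝ | dist q.1 q.2 ≤ 1 / (k + 1 : ℝ)}) = 0 := by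
    refine (Measure.measure_prod_null (MeasurableSet.iInter hmeas)).2 (ae_of_all _ fun x => ?_)
    refine measure_mono_null (fun y hy => ?_) (hμ x)
    have h0 : dist x y ≤ 0 := ge_of_tendsto' tendsto_one_div_add_atTop_nhds_zero_nat
      fun k => by simpa using Set.mem_iInter.1 hy k
    simpa [eq_comm] using dist_le_zero.1 h0
  rw [hdiag] at hlim
  have hpos : (0 : ℝ≥0∞) < ENNReal.ofReal (τ ^ 2) := by positivity
  obtain ⟨k, hk⟩ := ((tendsto_order.1 hlim).2 _ hpos).exists
  refine ⟨1 / (k + 1 : ℝ) / 2, by positivity, fun x => ?_⟩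
  have hsub : Metric.ball x (1 / (k + 1 : ℝ) / 2) ×ˢ Metric.ball x (1 / (k + 1 : ℝ) / 2) ⊆
      {q : ℝ × ℝ | dist q.1 q.2 ≤ 1 / (k + 1 : ℝ)} := by
    rintro ⟨a, b⟩ ⟨ha, hb⟩
    simp only [Metric.mem_ball, Set.mem_ofPred_eq] at ha hb ⊢
    linarith [dist_triangle_right a b x]
  have h := (measure_mono (μ := μ.prod μ) hsub).trans hk.le
  rw [Measure.prod_prod, ← sq] at h
  have h' := ENNReal.toReal_mono ENNReal.ofReal_ne_top h
  rw [ENNReal.toReal_pow, ENNReal.toReal_ofReal (by positivity)] at h'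
  exact le_of_sq_le_sq h' hτ.le

/-- Adding an independent variable does not increase concentration. -/
lemma measure_add_le_of_indepFun {Ω : Type*} [MeasurableSpace Ω] {P : Measure Ω}
    [IsProbabilityMeasure P] {U V : Ω → ℝ} (hU : AEMeasurable U P) (hV : AEMeasurable V P)
    (h : IndepFun U V P) {δ τ : ℝ} (hτ : 0 ≤ τ)
    (hle : ∀ x, P.real {ω | |V ω - x| < δ} ≤ τ) (x : ℝ) :
    P.real {ω | |U ω + V ω - x| < δ} ≤ τ := by
  have hs : MeasurableSet {q : ℝ × ℝ | |q.1 + q.2 - x| < δ} :=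
    measurableSet_lt (by fun_prop) measurable_const
  have h1 : P {ω | |U ω + V ω - x| < δ} =
      ((P.map U).prod (P.map V)) {q : ℝ × ℝ | |q.1 + q.2 - x| < δ} := by
    rw [← (indepFun_iff_map_prod_eq_prod_map_map hU hV).1 h,
      Measure.map_apply_of_aemeasurable (hU.prodMk hV) hs]
    rfl
  have : IsProbabilityMeasure (P.map U) := Measure.isProbabilityMeasure_map hU
  have h2 : P {ω | |U ω + V ω - x| < δ} ≤ ENNReal.ofReal τ := by
    rw [h1, Measure.prod_apply hs]
    calc _ ≤ ∫⁻ _, ENNReal.ofReal τ ∂(P.map U) := by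
          refine lintegral_mono fun u => ?_
          rw [Measure.map_apply_of_aemeasurable hV (measurable_prodMk_left hs)]
          rw [← ofReal_measureReal]
          refine ENNReal.ofReal_le_ofReal (le_trans (le_of_eq ?_) (hle (x - u)))
          congr 1
          ext ω
          simp only [Set.mem_preimage, Set.mem_ofPred_eq]
          rw [show V ω - (x - u) = u + V ω - x by ring]
      _ = ENNReal.ofReal τ := by simp
  exact ENNReal.toReal_le_of_le_ofReal hτ h2

/-- Gaussian decay of the characteristic function near the origin, from its second-order Taylor
expansion. -/
lemma exists_norm_charFun_le (μ : Measure ℝ) [IsProbabilityMeasure μ]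
    (hmean : ∫ x, x ∂μ = 0) (hvar : 0 < ∫ x, x ^ 2 ∂μ) :
    ∃ c > 0, ∃ T > 0, ∀ t, |t| ≤ T → ‖charFun μ t‖ ≤ Real.exp (-c * t ^ 2) := by
  set v := ∫ x, x ^ 2 ∂μ with hv
  set s := √v with hs
  have hs0 : 0 < s := Real.sqrt_pos.2 hvar
  have hs2 : s ^ 2 = v := Real.sq_sqrt hvar.le
  have key := taylor_charFun_two (P := μ) (X := fun x => s⁻¹ * x) (by fun_prop)
    (by rw [integral_const_mul, hmean, mul_zero])
    (by
      simp only [Pi.pow_apply, mul_pow]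
      rw [integral_const_mul, ← hv, inv_pow, hs2, inv_mul_cancel₀ hvar.ne'])
  have hb := key.bound (show (0 : ℝ) < 1 / 4 by norm_num)
  obtain ⟨r, hr, hball⟩ := Metric.eventually_nhds_iff.1 hb
  refine ⟨v / 4, by positivity, min (r / 2) 1 / s, by positivity, fun t ht => ?_⟩
  rw [le_div_iff₀ hs0, le_min_iff] at ht
  have hst : |s * t| = |t| * s := by rw [abs_mul, abs_of_pos hs0, mul_comm]
  have h1 : |s * t| ≤ 1 := hst ▸ ht.2
  have h2 := @hball (s * t) (by rw [Real.dist_eq, sub_zero, hst]; linarith [ht.1])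
  rw [charFun_map_mul, inv_mul_cancel_left₀ hs0.ne'] at h2
  have hsq : (s * t) ^ 2 ≤ 1 := by rw [← sq_abs]; exact pow_le_one₀ (abs_nonneg _) h1
  have h3 : ‖(1 : ℂ) - ((s * t : ℝ) : ℂ) ^ 2 / 2‖ = 1 - (s * t) ^ 2 / 2 := by
    rw [show (1 : ℂ) - ((s * t : ℝ) : ℂ) ^ 2 / 2 = ((1 - (s * t) ^ 2 / 2 : ℝ) : ℂ) by
      push_cast; ring, Complex.norm_real, Real.norm_of_nonneg (by linarith)]
  have h4 : ‖charFun μ t‖ ≤ 1 - (s * t) ^ 2 / 4 := by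
    have := norm_le_norm_add_norm_sub ((1 : ℂ) - ((s * t : ℝ) : ℂ) ^ 2 / 2) (charFun μ t)
    have h5 : ‖((s * t) ^ 2 : ℝ)‖ = (s * t) ^ 2 := Real.norm_of_nonneg (sq_nonneg _)
    rw [h5] at h2
    rw [norm_sub_rev _ (charFun μ t)] at this
    rw [h3] at this
    linarith
  refine h4.trans ?_
  have h6 := Real.add_one_le_exp (-(v / 4) * t ^ 2)
  have h7 : (s * t) ^ 2 = v * t ^ 2 := by rw [mul_pow, hs2]
  rw [h7]
  linarith

open Complex in
/-- Smoothing by a Gaussian: the mass of a short interval is controlled by a Gaussian average of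
the modulus of the characteristic function. -/
lemma measureReal_ball_le_integral_norm_charFun (ν : Measure ℝ) [IsProbabilityMeasure ν]
    {δ : ℝ} (hδ : 0 < δ) (x : ℝ) :
    ν.real {z | |z - x| < δ} ≤
      Real.exp (1 / 2) * ∫ t, ‖charFun ν t‖ ∂(gaussianReal 0 (δ ^ 2)⁻¹.toNNReal) := by
  set γ := gaussianReal 0 (δ ^ 2)⁻¹.toNNReal with hγ
  have : IsProbabilityMeasure γ := by rw [hγ]; infer_instance
  have hcoe : (((δ ^ 2)⁻¹.toNNReal : NNReal) : ℝ) = (δ ^ 2)⁻¹ :=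
    Real.coe_toNNReal _ (by positivity)
  have hker : ∀ z : ℝ, ∫ t, cexp (t * (z - x : ℝ) * I) ∂γ =
      (Real.exp (-((z - x) ^ 2 / δ ^ 2 / 2)) : ℂ) := by
    intro z
    have h := charFun_gaussianReal (μ := 0) (v := (δ ^ 2)⁻¹.toNNReal) (z - x)
    rw [charFun_apply_real] at h
    rw [hγ]
    calc _ = ∫ t, cexp ((z - x : ℝ) * t * I) ∂(gaussianReal 0 (δ ^ 2)⁻¹.toNNReal) := by
          simp_rw [mul_comm ((z - x : ℝ) : ℂ)]
      _ = _ := by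
          rw [h, hcoe]
          push_cast
          congr 1
          simp
          field_simp
  have hint : Integrable (fun q : ℝ × ℝ => cexp (q.2 * (q.1 - x : ℝ) * I)) (ν.prod γ) := by
    refine Integrable.of_bound (C := 1) (by fun_prop) (ae_of_all _ fun q => ?_)
    rw [← ofReal_mul, norm_exp_ofReal_mul_I]
  have hswap : ∫ z, ((Real.exp (-((z - x) ^ 2 / δ ^ 2 / 2)) : ℝ) : ℂ) ∂ν =
      ∫ t, cexp (-(t * x * I)) * charFun ν t ∂γ := by
    simp_rw [← hker]
    rw [integral_integral_swap hint]
    refine integral_congr_ae (ae_of_all _ fun t => ?_)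
    simp only
    rw [charFun_apply_real, ← integral_const_mul]
    refine integral_congr_ae (ae_of_all _ fun z => ?_)
    simp only
    rw [← Complex.exp_add]
    congr 1
    push_cast
    ring
  have hle : ∫ z, Real.exp (-((z - x) ^ 2 / δ ^ 2 / 2)) ∂ν ≤ ∫ t, ‖charFun ν t‖ ∂γ := by
    calc _ ≤ ‖∫ z, ((Real.exp (-((z - x) ^ 2 / δ ^ 2 / 2)) : ℝ) : ℂ) ∂ν‖ := by
          rw [integral_complex_ofReal, norm_real]
          exact le_abs_self _
      _ ≤ ∫ t, ‖cexp (-(t * x * I)) * charFun ν t‖ ∂γ := by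
          rw [hswap]; exact norm_integral_le_integral_norm _
      _ = _ := by
          refine integral_congr_ae (ae_of_all _ fun t => ?_)
          simp only
          rw [norm_mul, show -((t : ℂ) * x * I) = ((-(t * x) : ℝ) : ℂ) * I by push_cast; ring,
            norm_exp_ofReal_mul_I, one_mul]
  have hintR : Integrable (fun z => Real.exp (-((z - x) ^ 2 / δ ^ 2 / 2))) ν := by
    refine Integrable.of_bound (C := 1) (by fun_prop) (ae_of_all _ fun z => ?_)
    rw [Real.norm_of_nonneg (Real.exp_nonneg _), Real.exp_le_one_iff]
    exact neg_nonpos.2 (by positivity)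
  have hmarkov := mul_meas_ge_le_integral_of_nonneg (μ := ν)
    (ae_of_all _ fun z => Real.exp_nonneg (-((z - x) ^ 2 / δ ^ 2 / 2))) hintR (Real.exp (-(1 / 2)))
  have hsub : ν.real {z | |z - x| < δ} ≤
      ν.real {z | Real.exp (-(1 / 2)) ≤ Real.exp (-((z - x) ^ 2 / δ ^ 2 / 2))} := by
    refine measureReal_mono fun z hz => ?_
    simp only [Set.mem_ofPred_eq, Real.exp_le_exp] at hz ⊢
    have : (z - x) ^ 2 / δ ^ 2 ≤ 1 := by
      rw [div_le_one (by positivity), ← sq_abs]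
      exact pow_le_pow_left₀ (abs_nonneg _) hz.le 2
    linarith
  calc _ ≤ _ := hsub
    _ = Real.exp (1 / 2) * (Real.exp (-(1 / 2)) *
          ν.real {z | Real.exp (-(1 / 2)) ≤ Real.exp (-((z - x) ^ 2 / δ ^ 2 / 2))}) := by
        rw [← mul_assoc, ← Real.exp_add]; simp
    _ ≤ _ := by gcongr; exact hmarkov.trans hle

lemma integral_exp_neg_mul_sq_gaussianReal_le {δ c : ℝ} (hδ : 0 < δ) (hc : 0 < c) :
    ∫ t, Real.exp (-c * t ^ 2) ∂(gaussianReal 0 (δ ^ 2)⁻¹.toNNReal) ≤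
      δ * √(Real.pi / c) := by
  have hv : (Real.toNNReal (δ ^ 2)⁻¹) ≠ 0 := by
    rw [Ne, Real.toNNReal_eq_zero, not_le]; positivity
  rw [integral_gaussianReal_eq_integral_smul hv]
  have hpdf : ∀ t, gaussianPDFReal 0 (δ ^ 2)⁻¹.toNNReal t ≤ δ := by
    intro t
    rw [gaussianPDFReal_def]
    rw [Real.coe_toNNReal _ (by positivity)]
    have h1 : Real.exp (-(t - 0) ^ 2 / (2 * (δ ^ 2)⁻¹)) ≤ 1 := by
      rw [Real.exp_le_one_iff]
      exact div_nonpos_of_nonpos_of_nonneg (neg_nonpos.2 (sq_nonneg _)) (by positivity)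
    have h2 : (√(2 * Real.pi * (δ ^ 2)⁻¹))⁻¹ ≤ δ := by
      rw [inv_le_comm₀ (Real.sqrt_pos.2 (by positivity)) hδ]
      refine Real.le_sqrt_of_sq_le ?_
      rw [inv_pow]
      have : (0 : ℝ) < (δ ^ 2)⁻¹ := by positivity
      nlinarith [Real.pi_gt_three]
    calc _ ≤ δ * 1 := mul_le_mul h2 h1 (Real.exp_nonneg _) hδ.le
      _ = δ := mul_one _
  calc _ ≤ ∫ t, δ * Real.exp (-c * t ^ 2) := by
        refine integral_mono_of_nonneg (ae_of_all _ fun t => ?_)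
          ((integrable_exp_neg_mul_sq hc).const_mul _) (ae_of_all _ fun t => ?_)
        · exact mul_nonneg (gaussianPDFReal_nonneg _ _ _) (Real.exp_nonneg _)
        · exact mul_le_mul_of_nonneg_right (hpdf t) (Real.exp_nonneg _)
    _ = _ := by rw [integral_const_mul, integral_gaussian]

lemma integral_sq_gaussianReal (v : NNReal) : ∫ t, t ^ 2 ∂(gaussianReal 0 v) = v := by
  have h := variance_id_gaussianReal (μ := 0) (v := v)
  rw [variance_eq_integral (by fun_prop)] at h
  simpa using h

/-- Small coefficients: the characteristic function of the weighted sum decays like a Gaussian on a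
long interval, because all factors are evaluated near the origin. -/
lemma exists_measureReal_weightedSum_le_of_small (μ : Measure ℝ) [IsProbabilityMeasure μ]
    (hmean : ∫ x, x ∂μ = 0) (hvar : 0 < ∫ x, x ^ 2 ∂μ)
    {Ω : Type*} [MeasurableSpace Ω] (P : Measure Ω) [IsProbabilityMeasure P]
    {τ c₀ : ℝ} (hτ : 0 < τ) (hc₀ : 0 < c₀) :
    ∃ δ > 0, ∃ η > 0, ∀ (n : ℕ) (ε : Fin n → Ω → ℝ), iIndepFun ε P →
      (∀ i, AEMeasurable (ε i) P) → (∀ i, P.map (ε i) = μ) → ∀ a : Fin n → ℝ,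
      c₀ ≤ ∑ i, a i ^ 2 → (∀ i, |a i| ≤ η) → ∀ x,
      P.real {ω | |∑ i, a i * ε i ω - x| < δ} ≤ τ := by
  obtain ⟨c, hc, T, hT, hdecay⟩ := exists_norm_charFun_le μ hmean hvar
  set K := Real.exp (1 / 2) with hK
  have hKpos : 0 < K := Real.exp_pos _
  set M := √(Real.pi / (c * c₀)) with hM
  have hMpos : 0 < M := Real.sqrt_pos.2 (by positivity)
  -- `δ` and `η` make the two terms of the final bound equal to `τ / 2` each
  set δ := τ / (2 * K * M) with hδ
  have hδpos : 0 < δ := by positivity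
  set η := T * δ * √(τ / (2 * K)) with hη
  have hηpos : 0 < η := by positivity
  refine ⟨δ, hδpos, η, hηpos, fun n ε hind hmeas hlaw a ha hsmall x => ?_⟩
  have hSmeas : AEMeasurable (fun ω => ∑ i, a i * ε i ω) P :=
    Finset.aemeasurable_fun_sum _ fun i _ => (hmeas i).const_mul _
  set ν := P.map (fun ω => ∑ i, a i * ε i ω) with hν
  have : IsProbabilityMeasure ν := Measure.isProbabilityMeasure_map hSmeas
  have hcf : ∀ t, charFun ν t = ∏ i, charFun μ (a i * t) := by
    intro t
    have hind' : iIndepFun (fun i ω => a i * ε i ω) P :=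
      hind.comp (fun i y => a i * y) fun i => by fun_prop
    rw [hν, hind'.charFun_map_fun_sum_eq_prod fun i => (hmeas i).const_mul _, Finset.prod_apply]
    refine Finset.prod_congr rfl fun i _ => ?_
    rw [charFun_map_mul_comp (hmeas i), hlaw]
  -- for `|t| > T / η` the second summand exceeds one and the trivial bound suffices
  have hbound : ∀ t, ‖charFun ν t‖ ≤ Real.exp (-(c * c₀) * t ^ 2) + (η / T) ^ 2 * t ^ 2 := by
    intro t
    rcases le_or_gt (η * |t|) T with hle | hgt
    · have h1 : ‖charFun ν t‖ ≤ Real.exp (-(c * c₀) * t ^ 2) := by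
        rw [hcf, norm_prod]
        calc ∏ i, ‖charFun μ (a i * t)‖ ≤ ∏ i, Real.exp (-c * (a i * t) ^ 2) := by
              refine Finset.prod_le_prod (fun i _ => norm_nonneg _) fun i _ => hdecay _ ?_
              rw [abs_mul]
              exact (mul_le_mul_of_nonneg_right (hsmall i) (abs_nonneg _)).trans hle
          _ = Real.exp (-c * t ^ 2 * ∑ i, a i ^ 2) := by
              rw [← Real.exp_sum, Finset.mul_sum]
              congr 1
              exact Finset.sum_congr rfl fun i _ => by ring
          _ ≤ _ := by
              rw [Real.exp_le_exp]
              nlinarith [mul_le_mul_of_nonneg_left ha (mul_nonneg hc.le (sq_nonneg t))]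
      have : 0 ≤ (η / T) ^ 2 * t ^ 2 := by positivity
      linarith
    · have h1 : ‖charFun ν t‖ ≤ 1 := norm_charFun_le_one t
      have h2 : 1 ≤ (η / T) ^ 2 * t ^ 2 := by
        rw [← sq_abs t, ← mul_pow]
        refine one_le_pow₀ ?_
        rw [div_mul_eq_mul_div, one_le_div hT]
        exact hgt.le
      have := Real.exp_nonneg (-(c * c₀) * t ^ 2)
      linarith
  have hint1 : Integrable (fun t => Real.exp (-(c * c₀) * t ^ 2))
      (gaussianReal 0 (δ ^ 2)⁻¹.toNNReal) := by
    refine Integrable.of_bound (C := 1) (by fun_prop) (ae_of_all _ fun t => ?_)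
    rw [Real.norm_of_nonneg (Real.exp_nonneg _), Real.exp_le_one_iff]
    have : 0 ≤ (c * c₀) * t ^ 2 := by positivity
    linarith
  have hint2 : Integrable (fun t : ℝ => (η / T) ^ 2 * t ^ 2)
      (gaussianReal 0 (δ ^ 2)⁻¹.toNNReal) :=
    ((memLp_id_gaussianReal 2).integrable_sq).const_mul _
  have hI : ∫ t, ‖charFun ν t‖ ∂(gaussianReal 0 (δ ^ 2)⁻¹.toNNReal) ≤
      δ * M + (η / T) ^ 2 * (δ ^ 2)⁻¹ := by
    calc _ ≤ ∫ t, (Real.exp (-(c * c₀) * t ^ 2) + (η / T) ^ 2 * t ^ 2)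
          ∂(gaussianReal 0 (δ ^ 2)⁻¹.toNNReal) :=
          integral_mono_of_nonneg (ae_of_all _ fun t => norm_nonneg _) (hint1.add hint2)
            (ae_of_all _ hbound)
      _ ≤ _ := by
          rw [integral_add hint1 hint2, integral_const_mul, integral_sq_gaussianReal,
            Real.coe_toNNReal _ (by positivity)]
          gcongr
          exact integral_exp_neg_mul_sq_gaussianReal_le hδpos (by positivity)
  have hset : P.real {ω | |∑ i, a i * ε i ω - x| < δ} = ν.real {z | |z - x| < δ} := by
    rw [hν, map_measureReal_apply_of_aemeasurable hSmeas
      (measurableSet_lt (by fun_prop) measurable_const)]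
    rfl
  rw [hset]
  calc _ ≤ K * ∫ t, ‖charFun ν t‖ ∂(gaussianReal 0 (δ ^ 2)⁻¹.toNNReal) :=
        measureReal_ball_le_integral_norm_charFun ν hδpos x
    _ ≤ K * (δ * M + (η / T) ^ 2 * (δ ^ 2)⁻¹) := by gcongr
    _ = τ := by
        have : (η / T) ^ 2 = δ ^ 2 * (τ / (2 * K)) := by
          rw [hη, mul_assoc, mul_div_cancel_left₀ _ hT.ne', mul_pow, Real.sq_sqrt (by positivity)]
        rw [this, hδ]
        field_simp
        ring

/-- Uniform anti-concentration: over all weighted sums of independent variables with a common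
atomless law and with squared weights summing to at least `c₀`, short intervals have uniformly small
probability. A large weight is handled by conditioning on the remaining summands, and otherwise all
weights are small. -/
theorem exists_measureReal_weightedSum_le (μ : Measure ℝ) [IsProbabilityMeasure μ]
    (hL2 : MemLp id 2 μ) (hmean : ∫ x, x ∂μ = 0) (hμ : ∀ x, μ {x} = 0)
    {Ω : Type*} [MeasurableSpace Ω] (P : Measure Ω) [IsProbabilityMeasure P]
    {τ c₀ : ℝ} (hτ : 0 < τ) (hc₀ : 0 < c₀) :
    ∃ δ > 0, ∀ (n : ℕ) (ε : Fin n → Ω → ℝ), iIndepFun ε P →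
      (∀ i, AEMeasurable (ε i) P) → (∀ i, P.map (ε i) = μ) → ∀ a : Fin n → ℝ,
      c₀ ≤ ∑ i, a i ^ 2 → ∀ x, P.real {ω | |∑ i, a i * ε i ω - x| < δ} ≤ τ := by
  have hvar : 0 < ∫ x, x ^ 2 ∂μ := by
    refine lt_of_le_of_ne (integral_nonneg fun x => sq_nonneg x) fun h0 => ?_
    have h1 := (integral_eq_zero_iff_of_nonneg (fun x => sq_nonneg x) hL2.integrable_sq).1 h0.symm
    have h2 : μ {(0 : ℝ)} = 1 := by
      rw [← prob_compl_eq_zero_iff (measurableSet_singleton _)]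
      refine measure_mono_null (fun x hx => ?_) (ae_iff.1 h1)
      simpa using hx
    simp [hμ] at h2
  obtain ⟨δ₁, hδ₁, η, hη, hsmall⟩ :=
    exists_measureReal_weightedSum_le_of_small μ hmean hvar P hτ hc₀
  obtain ⟨δ₂, hδ₂, hball⟩ := exists_forall_measure_ball_le μ hμ hτ
  refine ⟨min δ₁ (η * δ₂), by positivity, fun n ε hind hmeas hlaw a ha x => ?_⟩
  by_cases hcase : ∀ i, |a i| ≤ η
  · refine le_trans (measureReal_mono fun ω hω => ?_) (hsmall n ε hind hmeas hlaw a ha hcase x)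
    rw [Set.mem_ofPred_eq] at hω ⊢
    exact lt_of_lt_of_le hω (min_le_left _ _)
  push Not at hcase
  obtain ⟨i, hi⟩ := hcase
  have hind' : iIndepFun (fun i ω => a i * ε i ω) P :=
    hind.comp (fun i y => a i * y) fun i => by fun_prop
  have hmeas' : ∀ k, AEMeasurable (fun ω => a k * ε k ω) P := fun k => (hmeas k).const_mul _
  have hindep := hind'.indepFun_finsetSum_of_notMem₀ hmeas' (Finset.notMem_erase i Finset.univ)
  have hone : ∀ x, P.real {ω | |a i * ε i ω - x| < min δ₁ (η * δ₂)} ≤ τ := by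
    intro x
    have hai : 0 < |a i| := hη.trans hi
    have h1 : {ω | |a i * ε i ω - x| < min δ₁ (η * δ₂)} ⊆
        ε i ⁻¹' Metric.ball (x / a i) δ₂ := by
      intro ω hω
      have hω' : |a i * ε i ω - x| < η * δ₂ := lt_of_lt_of_le hω (min_le_right _ _)
      rw [Set.mem_preimage, Metric.mem_ball, Real.dist_eq]
      have h2 : |a i| * |ε i ω - x / a i| = |a i * ε i ω - x| := by
        rw [← abs_mul, mul_sub, mul_div_cancel₀ _ (abs_pos.1 hai)]
      have h3 : |a i| * |ε i ω - x / a i| < |a i| * δ₂ :=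
        h2 ▸ hω'.trans_le (mul_le_mul_of_nonneg_right hi.le hδ₂.le)
      exact lt_of_mul_lt_mul_left h3 hai.le
    refine (measureReal_mono h1).trans ?_
    rw [← map_measureReal_apply_of_aemeasurable (hmeas i) Metric.isOpen_ball.measurableSet, hlaw]
    exact hball _
  have hmain := measure_add_le_of_indepFun
    (Finset.aemeasurable_sum _ fun k _ => hmeas' k) (hmeas' i) hindep hτ.le hone x
  refine le_trans (le_of_eq ?_) hmain
  congr 1
  ext ω
  rw [Set.mem_ofPred_eq, Set.mem_ofPred_eq, Finset.sum_apply,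
    Finset.sum_erase_add _ (fun k => a k * ε k ω) (Finset.mem_univ i)]

/-! ### First-order conditions for the estimator -/

/-- The subgradient condition at a minimizer of a quadratic plus a multiple of the absolute
value. -/
lemma abs_le_and_mul_eq_of_forall_nonneg {A g w x : ℝ} (hA : 0 ≤ A)
    (h : ∀ s, 0 ≤ A * s ^ 2 + 2 * g * s + 2 * w * (|x + s| - |x|)) (hw : 0 ≤ w) :
    |g| ≤ w ∧ g * x = -(w * |x|) := by
  -- the quadratic term is removed by rescaling the direction `s` and using convexity
  have key : ∀ s, 0 ≤ g * s + w * (|x + s| - |x|) := by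
    intro s
    by_contra! hD
    set D := g * s + w * (|x + s| - |x|) with hDdef
    have hB : 0 ≤ A * s ^ 2 := by positivity
    set B := A * s ^ 2 with hBdef
    obtain ⟨τ, hτ0, hτ1, hτ⟩ : ∃ τ : ℝ, 0 < τ ∧ τ ≤ 1 ∧ τ * B ≤ -D := by
      refine ⟨min 1 (-D / (B + 1)), lt_min one_pos (div_pos (by linarith) (by linarith)),
        min_le_left _ _, ?_⟩
      calc min 1 (-D / (B + 1)) * B ≤ -D / (B + 1) * (B + 1) := by
            gcongr
            · exact div_nonneg (by linarith) (by linarith)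
            · exact min_le_right _ _
            · linarith
        _ = -D := div_mul_cancel₀ _ (by linarith)
    have hconv : |x + τ * s| - |x| ≤ τ * (|x + s| - |x|) := by
      have : x + τ * s = (1 - τ) * x + τ * (x + s) := by ring
      have h2 := abs_add_le ((1 - τ) * x) (τ * (x + s))
      rw [abs_mul, abs_mul, abs_of_nonneg (by linarith : 0 ≤ 1 - τ), abs_of_pos hτ0] at h2
      rw [this]
      linarith
    have h1 := h (τ * s)
    have h2 : 0 ≤ τ * (τ * B + 2 * D) := by
      calc 0 ≤ _ := h1
        _ ≤ A * (τ * s) ^ 2 + 2 * g * (τ * s) + 2 * w * (τ * (|x + s| - |x|)) := by gcongr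
        _ = _ := by rw [hBdef, hDdef]; ring
    have h3 := nonneg_of_mul_nonneg_right h2 hτ0
    linarith
  have h1 := key (-x)
  have h2 := key x
  rw [add_neg_cancel, abs_zero] at h1
  rw [← two_mul, abs_mul, abs_two] at h2
  refine ⟨abs_le.2 ⟨?_, ?_⟩, by linarith⟩
  · have h3 := key 1
    have h4 := mul_le_mul_of_nonneg_left (abs_add_le x 1) hw
    rw [abs_one] at h4
    linarith
  · have h3 := key (-1)
    have h4 := mul_le_mul_of_nonneg_left (abs_add_le x (-1)) hw
    rw [abs_neg, abs_one] at h4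
    linarith

section Subgradient

variable {n p : ℕ}

lemma exists_isMinOn_objective (X : Matrix (Fin n) (Fin p) ℝ) (hX : IsUnit (Xᵀ * X))
    (lam : Fin p → ℝ) (hlam : ∀ j, 0 ≤ lam j) (y : Fin n → ℝ) :
    ∃ b, IsMinOn (objective X lam y) Set.univ b := by
  set f : (Fin p → ℝ) →ₗ[ℝ] EuclideanSpace ℝ (Fin n) :=
    (WithLp.linearEquiv 2 ℝ (Fin n → ℝ)).symm.toLinearMap ∘ₗ X.mulVecLin with hf
  have hfapp : ∀ b, f b = WithLp.toLp 2 (X *ᵥ b) := fun b => rfl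
  have hinj : LinearMap.ker f = ⊥ := by
    rw [LinearMap.ker_eq_bot']
    intro b hb
    rw [hfapp, WithLp.toLp_eq_zero] at hb
    have h1 : (Xᵀ * X) *ᵥ b = 0 := by rw [← Matrix.mulVec_mulVec, hb, Matrix.mulVec_zero]
    exact Matrix.mulVec_injective_of_isUnit hX (h1.trans (Matrix.mulVec_zero _).symm)
  have hcoer : Tendsto (fun b => ‖f b‖) (cocompact _) atTop :=
    tendsto_norm_cocompact_atTop.comp
      (LinearMap.isClosedEmbedding_of_injective hinj).tendsto_cocompact
  have hcont : Continuous (objective X lam y) := by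
    unfold objective
    have : Continuous fun b => WithLp.toLp 2 (y - X *ᵥ b) :=
      (PiLp.continuous_toLp 2 _).comp (continuous_const.sub (Continuous.matrix_mulVec
        continuous_const continuous_id))
    refine (this.norm.pow 2).add (continuous_const.mul (continuous_finsetSum _ fun j _ => ?_))
    exact continuous_const.mul ((continuous_apply j).abs.div_const _)
  have hlim : Tendsto (objective X lam y) (cocompact _) atTop := by
    have h1 : Tendsto (fun b => (‖f b‖ - ‖WithLp.toLp 2 y‖) ^ 2) (cocompact _) atTop :=
      (tendsto_pow_atTop two_ne_zero).comp (tendsto_atTop_add_const_right _ _ hcoer)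
    refine tendsto_atTop_mono' _ ?_ h1
    filter_upwards [hcoer.eventually_ge_atTop ‖WithLp.toLp 2 y‖] with b hb
    have h2 : ‖f b‖ - ‖WithLp.toLp 2 y‖ ≤ ‖WithLp.toLp 2 (y - X *ᵥ b)‖ := by
      rw [hfapp, WithLp.toLp_sub, norm_sub_rev]
      exact norm_sub_norm_le _ _
    have h3 : 0 ≤ ∑ j, lam j * (|b j| / |leastSquares X y j|) :=
      Finset.sum_nonneg fun j _ => mul_nonneg (hlam j) (by positivity)
    have h4 := pow_le_pow_left₀ (sub_nonneg.2 hb) h2 2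
    unfold objective
    linarith
  obtain ⟨b, hb⟩ := hcont.exists_forall_le hlim
  exact ⟨b, fun b' _ => hb b'⟩

lemma norm_sq_toLp_eq_dotProduct (v : Fin n → ℝ) : ‖WithLp.toLp 2 v‖ ^ 2 = v ⬝ᵥ v := by
  rw [EuclideanSpace.real_norm_sq_eq]
  simp [dotProduct, sq]

/-- The normal equations in subgradient form: moving one coordinate of the estimator does not
decrease the objective. -/
lemma estimator_subgradient (X : Matrix (Fin n) (Fin p) ℝ) (hX : IsUnit (Xᵀ * X))
    (lam : Fin p → ℝ) (hlam : ∀ j, 0 ≤ lam j) (y : Fin n → ℝ) (j : Fin p) :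
    |((Xᵀ * X) *ᵥ (estimator X lam y - leastSquares X y)) j| ≤ lam j / |leastSquares X y j| ∧
    ((Xᵀ * X) *ᵥ (estimator X lam y - leastSquares X y)) j * estimator X lam y j =
      -(lam j / |leastSquares X y j| * |estimator X lam y j|) := by
  have hmin : IsMinOn (objective X lam y) Set.univ (estimator X lam y) :=
    Classical.epsilon_spec (exists_isMinOn_objective X hX lam hlam y)
  set b := estimator X lam y with hb
  have hLS : (Xᵀ * X) *ᵥ leastSquares X y = Xᵀ *ᵥ y := by
    unfold leastSquares
    rw [Matrix.mulVec_mulVec, Matrix.mul_nonsing_inv _ ((Matrix.isUnit_iff_isUnit_det _).1 hX),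
      Matrix.one_mulVec]
  set L := leastSquares X y with hL
  refine abs_le_and_mul_eq_of_forall_nonneg (A := (Xᵀ * X) j j) ?_ (fun s => ?_)
    (div_nonneg (hlam j) (abs_nonneg _))
  · rw [Matrix.mul_apply]
    exact Finset.sum_nonneg fun i _ => mul_self_nonneg _
  have h : objective X lam y b ≤ objective X lam y (b + Pi.single j s) := hmin (Set.mem_univ _)
  unfold objective at h
  rw [norm_sq_toLp_eq_dotProduct, norm_sq_toLp_eq_dotProduct] at h
  have hres : y - X *ᵥ (b + Pi.single j s) = (y - X *ᵥ b) - s • X.col j := by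
    rw [Matrix.mulVec_add, Matrix.mulVec_single, op_smul_eq_smul]
    abel
  have hcol : X.col j ⬝ᵥ X.col j = (Xᵀ * X) j j := by
    simp [Matrix.mul_apply, dotProduct]
  have hgrad : (y - X *ᵥ b) ⬝ᵥ X.col j = -((Xᵀ * X) *ᵥ (b - L)) j := by
    have : (y - X *ᵥ b) ⬝ᵥ X.col j = (Xᵀ *ᵥ (y - X *ᵥ b)) j := by
      simp [Matrix.mulVec, dotProduct, mul_comm]
    rw [this, Matrix.mulVec_sub, Matrix.mulVec_sub, hLS, Matrix.mulVec_mulVec]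
    simp
  have hpen : ∑ k, lam k * (|(b + (Pi.single j s : Fin p → ℝ)) k| / |L k|) =
      ∑ k, lam k * (|b k| / |L k|) + lam j / |L j| * (|b j + s| - |b j|) := by
    rw [← sub_eq_iff_eq_add', ← Finset.sum_sub_distrib, Finset.sum_eq_single j]
    · simp only [Pi.add_apply, Pi.single_eq_same]; ring
    · intro k _ hk; simp [hk]
    · simp
  have hexp : ∀ u c : Fin n → ℝ,
      (u - s • c) ⬝ᵥ (u - s • c) = u ⬝ᵥ u - 2 * s * (u ⬝ᵥ c) + s ^ 2 * (c ⬝ᵥ c) := by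
    intro u c
    simp only [dotProduct_sub, sub_dotProduct, smul_dotProduct, dotProduct_smul, smul_eq_mul]
    rw [dotProduct_comm c u]
    ring
  rw [← hL, hres, hpen, hexp, hcol, hgrad] at h
  linarith

/-- The subgradient condition in the local scale `r = √(lam*/n)`. In the second conclusion
the weight `1 / |β̂_LS,ⱼ|` has cancelled, because the penalty at `β̂_LS` is at most `lamⱼ` in each
coordinate. -/
lemma scaled_subgradient (X : Matrix (Fin n) (Fin p) ℝ) (hX : IsUnit (Xᵀ * X))
    (lam : Fin p → ℝ) (hlam : ∀ j, 0 ≤ lam j) (y : Fin n → ℝ) {Λ : ℝ} (hΛ : 0 < Λ) (hn : 0 < n)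
    {v : Fin p → ℝ} (hv : v = (√(Λ / n))⁻¹ • (estimator X lam y - leastSquares X y)) (j : Fin p) :
    |(((n : ℝ)⁻¹ • (Xᵀ * X)) *ᵥ v) j| ≤ lam j / Λ * (√(Λ / n) / |leastSquares X y j|) ∧
    v j * (((n : ℝ)⁻¹ • (Xᵀ * X)) *ᵥ v) j ≤ lam j / Λ ∧
    (((n : ℝ)⁻¹ • (Xᵀ * X)) *ᵥ v) j * estimator X lam y j =
      -(lam j / Λ * (√(Λ / n) / |leastSquares X y j|) * |estimator X lam y j|) := by
  obtain ⟨h1, h2⟩ := estimator_subgradient X hX lam hlam y j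
  have hn' : (0 : ℝ) < n := by exact_mod_cast hn
  have hr : 0 < √(Λ / n) := Real.sqrt_pos.2 (by positivity)
  have hr2 : √(Λ / n) ^ 2 * n = Λ := by
    rw [Real.sq_sqrt (by positivity), div_mul_cancel₀ _ hn'.ne']
  set r := √(Λ / n) with hrdef
  set L := leastSquares X y with hL
  set b := estimator X lam y with hb
  have hG : (((n : ℝ)⁻¹ • (Xᵀ * X)) *ᵥ v) j = (n * r)⁻¹ * ((Xᵀ * X) *ᵥ (b - L)) j := by
    rw [hv, Matrix.smul_mulVec, Matrix.mulVec_smul, smul_smul, mul_inv, Pi.smul_apply, smul_eq_mul]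
  have hw : lam j / Λ * (r / |L j|) = (n * r)⁻¹ * (lam j / |L j|) := by
    rw [← hr2]
    field_simp
  set g := ((Xᵀ * X) *ᵥ (b - L)) j with hg
  have hnr : 0 < (n * r)⁻¹ := by positivity
  refine ⟨?_, ?_, ?_⟩
  · rw [hG, hw, abs_mul, abs_of_pos hnr]
    exact mul_le_mul_of_nonneg_left h1 hnr.le
  · have hvj : v j = r⁻¹ * (b j - L j) := by rw [hv]; rfl
    have hle : (b j - L j) * g ≤ lam j := by
      have h3 : -(g * L j) ≤ lam j := by
        calc -(g * L j) ≤ |g| * |L j| := by rw [← abs_mul]; exact neg_le_abs _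
          _ ≤ lam j / |L j| * |L j| := by gcongr
          _ ≤ lam j := by
              rcases eq_or_ne |L j| 0 with h0 | h0
              · simpa [h0] using hlam j
              · rw [div_mul_cancel₀ _ h0]
      have h4 : 0 ≤ lam j / |L j| * |b j| :=
        mul_nonneg (div_nonneg (hlam j) (abs_nonneg _)) (abs_nonneg _)
      linarith
    rw [hG, hvj]
    calc r⁻¹ * (b j - L j) * ((n * r)⁻¹ * g) = (b j - L j) * g / (r ^ 2 * n) := by
          field_simp
      _ ≤ lam j / Λ := by rw [hr2]; gcongr
  · rw [hG, hw]
    linear_combination (n * r)⁻¹ * h2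

end Subgradient

/-! ### Limits of solutions of the first-order conditions -/

/-- Compactness principle: a condition that fails along every ultrafilter for which the tolerance
tends to zero and the sample size to infinity fails for some fixed tolerance and all large sample
sizes, uniformly in the remaining data. -/
lemma exists_pos_eventually_forall_not {α : Type*} {q : ℝ → ℕ → α → Prop}
    (h : ∀ (U : Ultrafilter (ℝ × ℕ)) (f : ℝ × ℕ → α), ↑U ≤ 𝓝[>] (0 : ℝ) ×ˢ atTop (α := ℕ) →
      ¬ ∀ᶠ z in (U : Filter (ℝ × ℕ)), q z.1 z.2 (f z)) :
    ∃ η > 0, ∀ᶠ n in atTop, ∀ x, ¬ q η n x := by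
  have hev : ∀ᶠ z in 𝓝[>] (0 : ℝ) ×ˢ atTop (α := ℕ), ∀ x, ¬ q z.1 z.2 x := by
    by_contra hcon
    have hfreq : ∃ᶠ z in 𝓝[>] (0 : ℝ) ×ˢ atTop (α := ℕ), ∃ x, q z.1 z.2 x := by
      refine fun h' => hcon (h'.mono fun z hz x hx => hz ⟨x, hx⟩)
    have : NeBot ((𝓝[>] (0 : ℝ) ×ˢ atTop (α := ℕ)) ⊓ 𝓟 {z | ∃ x, q z.1 z.2 x}) :=
      frequently_mem_iff_neBot.1 hfreq
    obtain ⟨U, hU⟩ := Ultrafilter.exists_le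
      ((𝓝[>] (0 : ℝ) ×ˢ atTop (α := ℕ)) ⊓ 𝓟 {z | ∃ x, q z.1 z.2 x})
    have hq : ∀ᶠ z in (U : Filter (ℝ × ℕ)), ∃ x, q z.1 z.2 x :=
      (hU.trans inf_le_right) (mem_principal_self _)
    have : Nonempty α := hq.exists.elim fun _ hx => ⟨hx.choose⟩
    obtain ⟨f, hf⟩ := hq.choice
    exact h U f (hU.trans inf_le_left) hf
  obtain ⟨pa, ha, pb, hb, hab⟩ := eventually_prod_iff.1 hev
  obtain ⟨η, hη, hη0⟩ := (ha.and self_mem_nhdsWithin).exists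
  exact ⟨η, hη0, hb.mono fun n hn => hab hη hn⟩

section Limits

variable {p : ℕ}

/-- Coercivity of a positive definite form, locally uniform in the matrix. -/
lemma exists_forall_mul_norm_sq_le {C : Matrix (Fin p) (Fin p) ℝ} (hC : C.PosDef) :
    ∃ c > 0, ∀ᶠ A in 𝓝 C, ∀ v : Fin p → ℝ, c * ‖v‖ ^ 2 ≤ v ⬝ᵥ A *ᵥ v := by
  have hcont : Continuous fun z : Matrix (Fin p) (Fin p) ℝ × (Fin p → ℝ) => z.2 ⬝ᵥ z.1 *ᵥ z.2 :=
    continuous_snd.dotProduct (continuous_fst.matrix_mulVec continuous_snd)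
  have hcpt := isCompact_sphere (0 : Fin p → ℝ) 1
  obtain ⟨c, hc, hle⟩ := hcpt.exists_forall_le'
    (f := fun v => v ⬝ᵥ C *ᵥ v) (hcont.comp (Continuous.prodMk_right C)).continuousOn (a := 0)
    fun v hv => by
      have hv0 : v ≠ 0 := by rintro rfl; simp at hv
      simpa using hC.dotProduct_mulVec_pos hv0
  refine ⟨c / 2, by positivity, ?_⟩
  have hsph := hcpt.eventually_forall_of_forall_eventually (x₀ := C)
    (P := fun A v => c / 2 < v ⬝ᵥ A *ᵥ v) fun v hv =>
      hcont.continuousAt.eventually_const_lt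
        (by simpa using lt_of_lt_of_le (by linarith) (hle v hv))
  filter_upwards [hsph] with A hA v
  rcases eq_or_ne v 0 with rfl | hv
  · simp
  · have hnv : 0 < ‖v‖ := norm_pos_iff.2 hv
    have h1 := hA (‖v‖⁻¹ • v) (by simp [norm_smul, hnv.ne'])
    simp only [Matrix.mulVec_smul, smul_dotProduct, dotProduct_smul, smul_eq_mul] at h1
    have h2 : v ⬝ᵥ A *ᵥ v = ‖v‖ ^ 2 * (‖v‖⁻¹ * (‖v‖⁻¹ * v ⬝ᵥ A *ᵥ v)) := by
      field_simp
    rw [h2, mul_comm]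
    gcongr

/-- The first-order conditions bound the rescaled deviation from least squares, so it converges
along every ultrafilter. -/
lemma exists_tendsto_of_mul_mulVec_le {C : Matrix (Fin p) (Fin p) ℝ} (hC : C.PosDef)
    {ι : Type*} (U : Ultrafilter ι) {A : ι → Matrix (Fin p) (Fin p) ℝ}
    (hA : Tendsto A U (𝓝 C)) {l : ι → Fin p → ℝ} {lam0 : Fin p → ℝ}
    (hl : ∀ j, Tendsto (fun z => l z j) U (𝓝 (lam0 j))) {v : ι → Fin p → ℝ}
    (hv : ∀ᶠ z in (U : Filter ι), ∀ j, v z j * (A z *ᵥ v z) j ≤ l z j) :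
    ∃ m, Tendsto v U (𝓝 m) := by
  obtain ⟨c, hc, hle⟩ := exists_forall_mul_norm_sq_le hC
  set S := ∑ j, lam0 j with hS
  have hsum : ∀ᶠ z in (U : Filter ι), ∑ j, l z j ≤ S + 1 :=
    ((tendsto_finsetSum _ fun j _ => hl j).eventually_lt_const (lt_add_one S)).mono
      fun _ h => h.le
  have hbdd : ∀ᶠ z in (U : Filter ι), v z ∈ Metric.closedBall (0 : Fin p → ℝ) √((S + 1) / c) := by
    filter_upwards [hA.eventually hle, hsum, hv] with z h1 h2 h3
    rw [mem_closedBall_zero_iff]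
    refine Real.le_sqrt_of_sq_le ?_
    rw [le_div_iff₀ hc, mul_comm]
    exact ((h1 (v z)).trans (Finset.sum_le_sum fun j _ => h3 j)).trans h2
  obtain ⟨m, -, hm⟩ := (isCompact_closedBall _ _).ultrafilter_le_nhds (U.map v)
    (le_principal_iff.2 hbdd)
  exact ⟨m, hm⟩

/-- Approximate solutions of the limiting conditions lie in any given open neighbourhood of the
limit set, uniformly. -/
lemma exists_pos_eventually_mem_of_isOpen {C : Matrix (Fin p) (Fin p) ℝ} (hC : C.PosDef)
    {A : ℕ → Matrix (Fin p) (Fin p) ℝ} (hA : Tendsto A atTop (𝓝 C))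
    {l : ℕ → Fin p → ℝ} {lam0 : Fin p → ℝ}
    (hl : ∀ j, Tendsto (fun n => l n j) atTop (𝓝 (lam0 j))) (ψ : Fin p → ℝ≥0∞)
    {O : Set (Fin p → ℝ)} (hO : IsOpen O) (hMO : minimizerSet C lam0 ψ ⊆ O) :
    ∃ η > 0, ∀ᶠ n in atTop, ∀ v e : Fin p → ℝ, (∀ j, v j * (A n *ᵥ v) j ≤ l n j) →
      (∀ j, ψ j = ∞ → |(A n *ᵥ v) j| ≤ η) → (∀ j, |e j| ≤ η) → v + e ∈ O := by
  have hex := exists_pos_eventually_forall_not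
    (q := fun η n (x : (Fin p → ℝ) × (Fin p → ℝ)) => (∀ j, x.1 j * (A n *ᵥ x.1) j ≤ l n j) ∧
      (∀ j, ψ j = ∞ → |(A n *ᵥ x.1) j| ≤ η) ∧ (∀ j, |x.2 j| ≤ η) ∧ x.1 + x.2 ∉ O) ?_
  · obtain ⟨η, hη, h⟩ := hex
    refine ⟨η, hη, h.mono fun n hn v e h1 h2 h3 => ?_⟩
    by_contra hcon
    exact hn (v, e) ⟨h1, h2, h3, hcon⟩
  intro U f hU hq
  have hη : Tendsto Prod.fst (U : Filter (ℝ × ℕ)) (𝓝 (0 : ℝ)) :=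
    (tendsto_fst.mono_right nhdsWithin_le_nhds).mono_left hU
  have hn : Tendsto Prod.snd (U : Filter (ℝ × ℕ)) atTop := tendsto_snd.mono_left hU
  have hA' := hA.comp hn
  obtain ⟨m, hm⟩ := exists_tendsto_of_mul_mulVec_le hC U hA' (fun j => (hl j).comp hn)
    (v := fun z => (f z).1) (hq.mono fun z hz => hz.1)
  have hG : Tendsto (fun z => A z.2 *ᵥ (f z).1) U (𝓝 (C *ᵥ m)) :=
    ((continuous_fst.matrix_mulVec continuous_snd).tendsto (C, m)).comp (hA'.prodMk_nhds hm)
  have he : Tendsto (fun z => (f z).2) U (𝓝 0) := by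
    refine tendsto_pi_nhds.2 fun j => ?_
    exact squeeze_zero_norm' (hq.mono fun z hz => hz.2.2.1 j) hη
  have hmM : m ∈ minimizerSet C lam0 ψ := by
    intro j
    have hGj := tendsto_pi_nhds.1 hG j
    refine ⟨fun hj => ?_, fun _ => ?_⟩
    · exact abs_eq_zero.1 (le_antisymm
        (le_of_tendsto_of_tendsto hGj.abs hη (hq.mono fun z hz => hz.2.1 j hj)) (abs_nonneg _))
    · exact le_of_tendsto_of_tendsto ((tendsto_pi_nhds.1 hm j).mul hGj) ((hl j).comp hn)
        (hq.mono fun z hz => hz.1 j)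
  have hsum : Tendsto (fun z => (f z).1 + (f z).2) U (𝓝 m) := by simpa using hm.add he
  obtain ⟨z, h1, h2⟩ := (hq.and (hsum.eventually (hO.mem_nhds (hMO hmM)))).exists
  exact h1.2.2.2 h2

/-- Non-coverage at the critical parameter: a coordinate `j₀` at distance `t * r` from zero with
`t ^ 2 = (C⁻¹) j₀ j₀`, and all others of order one. Then `(C m)ₖ = 0` for `k ≠ j₀` in the limit, and
the limit point has `m j₀ * (C m) j₀ = 1`, on the boundary of the limit set. -/
lemma exists_pos_eventually_notMem {C : Matrix (Fin p) (Fin p) ℝ} (hC : C.PosDef)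
    {A : ℕ → Matrix (Fin p) (Fin p) ℝ} (hA : Tendsto A atTop (𝓝 C))
    {l : ℕ → Fin p → ℝ} {lam0 : Fin p → ℝ}
    (hl : ∀ j, Tendsto (fun n => l n j) atTop (𝓝 (lam0 j))) (ψ : Fin p → ℝ≥0∞)
    {r : ℕ → ℝ} (hr : Tendsto r atTop (𝓝 0)) {j₀ : Fin p} (hlam0 : lam0 j₀ = 1)
    (hψ : ψ j₀ < ∞) {d : ℝ} (hd : d < 1) {t : ℝ} (ht : 0 < t) (ht2 : t ^ 2 = C⁻¹ j₀ j₀) :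
    ∃ η > 0, ∀ᶠ n in atTop, ∀ v e : Fin p → ℝ, (∀ j, v j * (A n *ᵥ v) j ≤ l n j) →
      (∀ k, k ≠ j₀ → |(A n *ᵥ v) k| ≤ l n k * (r n / |1 + r n * e k|)) →
      (A n *ᵥ v) j₀ * (t + (v + e) j₀) = -(l n j₀ * (1 / |t + e j₀|) * |t + (v + e) j₀|) →
      (∀ j, |e j| ≤ η) → v + e ∉ minimizerSet C (d • lam0) ψ := by
  have hex := exists_pos_eventually_forall_not
    (q := fun η n (x : (Fin p → ℝ) × (Fin p → ℝ)) => (∀ j, x.1 j * (A n *ᵥ x.1) j ≤ l n j) ∧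
      (∀ k, k ≠ j₀ → |(A n *ᵥ x.1) k| ≤ l n k * (r n / |1 + r n * x.2 k|)) ∧
      (A n *ᵥ x.1) j₀ * (t + (x.1 + x.2) j₀) =
        -(l n j₀ * (1 / |t + x.2 j₀|) * |t + (x.1 + x.2) j₀|) ∧
      (∀ j, |x.2 j| ≤ η) ∧ x.1 + x.2 ∈ minimizerSet C (d • lam0) ψ) ?_
  · obtain ⟨η, hη, h⟩ := hex
    exact ⟨η, hη, h.mono fun n hn v e h1 h2 h3 h4 h5 => hn (v, e) ⟨h1, h2, h3, h4, h5⟩⟩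
  intro U f hU hq
  have hη : Tendsto Prod.fst (U : Filter (ℝ × ℕ)) (𝓝 (0 : ℝ)) :=
    (tendsto_fst.mono_right nhdsWithin_le_nhds).mono_left hU
  have hn : Tendsto Prod.snd (U : Filter (ℝ × ℕ)) atTop := tendsto_snd.mono_left hU
  have hA' := hA.comp hn
  obtain ⟨m, hm⟩ := exists_tendsto_of_mul_mulVec_le hC U hA' (fun j => (hl j).comp hn)
    (v := fun z => (f z).1) (hq.mono fun z hz => hz.1)
  have hG : Tendsto (fun z => A z.2 *ᵥ (f z).1) U (𝓝 (C *ᵥ m)) :=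
    ((continuous_fst.matrix_mulVec continuous_snd).tendsto (C, m)).comp (hA'.prodMk_nhds hm)
  have hGj := fun j => tendsto_pi_nhds.1 hG j
  have he : Tendsto (fun z => (f z).2) U (𝓝 0) := by
    refine tendsto_pi_nhds.2 fun j => ?_
    exact squeeze_zero_norm' (hq.mono fun z hz => hz.2.2.2.1 j) hη
  have hej := fun j => tendsto_pi_nhds.1 he j
  have hr' := hr.comp hn
  have hsum : Tendsto (fun z => (f z).1 + (f z).2) U (𝓝 m) := by simpa using hm.add he
  have hzero : ∀ k, k ≠ j₀ → (C *ᵥ m) k = 0 := by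
    intro k hk
    have hlim : Tendsto (fun z => l z.2 k * (r z.2 / |1 + r z.2 * (f z).2 k|)) U
        (𝓝 (lam0 k * (0 / |1 + 0 * (0 : Fin p → ℝ) k|))) :=
      ((hl k).comp hn).mul (hr'.div ((hr'.mul (hej k)).const_add 1).abs (by simp))
    rw [zero_div, mul_zero] at hlim
    exact abs_eq_zero.1 (le_antisymm
      (le_of_tendsto_of_tendsto (hGj k).abs hlim (hq.mono fun z hz => hz.2.1 k hk))
      (abs_nonneg _))
  set g := (C *ᵥ m) j₀ with hg
  have hmj : m j₀ = t ^ 2 * g := by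
    have h1 : m = C⁻¹ *ᵥ (C *ᵥ m) := by
      rw [Matrix.mulVec_mulVec, Matrix.nonsing_inv_mul _
        ((Matrix.isUnit_iff_isUnit_det _).1 hC.isUnit), Matrix.one_mulVec]
    rw [h1, Matrix.mulVec, dotProduct, Finset.sum_eq_single j₀, ht2]
    · intro k _ hk; rw [hzero k hk, mul_zero]
    · simp
  have heq : g * (t + m j₀) = -(1 / t * |t + m j₀|) := by
    have hbj := (tendsto_pi_nhds.1 hsum j₀).const_add t
    have hw : Tendsto (fun z => l z.2 j₀ * (1 / |t + (f z).2 j₀|)) U (𝓝 (1 * (1 / |t + 0|))) :=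
      (hlam0 ▸ (hl j₀).comp hn).mul (tendsto_const_nhds.div ((hej j₀).const_add t).abs
        (by simpa using ht.ne'))
    rw [add_zero, one_mul, abs_of_pos ht] at hw
    exact tendsto_nhds_unique_of_eventuallyEq ((hGj j₀).mul hbj) ((hw.mul hbj.abs).neg)
      (hq.mono fun z hz => hz.2.2.1)
  have hle : m j₀ * g ≤ d := by
    have hCm : Tendsto (fun z => C *ᵥ ((f z).1 + (f z).2)) U (𝓝 (C *ᵥ m)) :=
      ((continuous_const.matrix_mulVec continuous_id).tendsto m).comp hsum
    have hlim : Tendsto (fun z => ((f z).1 + (f z).2) j₀ *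
        (C *ᵥ ((f z).1 + (f z).2)) j₀) U (𝓝 (m j₀ * g)) :=
      (tendsto_pi_nhds.1 hsum j₀).mul (tendsto_pi_nhds.1 hCm j₀)
    refine le_of_tendsto hlim (hq.mono fun z hz => ?_)
    simpa [hlam0] using (hz.2.2.2.2 j₀).2 hψ
  -- in terms of `h = t * g` the limiting condition reads `h * (1 + h) = -|1 + h|`
  have hh : t * g * (1 + t * g) = -|1 + t * g| := by
    have h1 : t + m j₀ = t * (1 + t * g) := by rw [hmj]; ring
    rw [h1, abs_mul, abs_of_pos ht] at heq
    field_simp at heq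
    rw [mul_comm t g]
    linear_combination heq
  have hone : t * g = -1 := by
    rcases lt_trichotomy (1 + t * g) 0 with hlt | heq0 | hgt
    · rw [abs_of_neg hlt] at hh
      have : (1 + t * g) * (t * g - 1) = 0 := by linear_combination hh
      rcases mul_eq_zero.1 this with h1 | h1 <;> linarith
    · linarith
    · rw [abs_of_pos hgt] at hh
      have : (1 + t * g) * (t * g + 1) = 0 := by linear_combination hh
      rcases mul_eq_zero.1 this with h1 | h1 <;> linarith
  have : m j₀ * g = 1 := by
    rw [hmj]
    linear_combination (t * g - 1) * hone
  linarith

end Limits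

/-! ### The least-squares error -/

section LeastSquares

variable {n p : ℕ} {Ω : Type*}

lemma leastSquares_response {X : Matrix (Fin n) (Fin p) ℝ} (hX : IsUnit (Xᵀ * X))
    (ε : Fin n → Ω → ℝ) (β : Fin p → ℝ) (ω : Ω) :
    leastSquares X (response X ε β ω) = β + leastSquares X fun i => ε i ω := by
  unfold leastSquares response
  rw [Matrix.mulVec_add, Matrix.mulVec_add, Matrix.mulVec_mulVec, Matrix.mulVec_mulVec,
    Matrix.mul_assoc, Matrix.nonsing_inv_mul _ ((Matrix.isUnit_iff_isUnit_det _).1 hX),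
    Matrix.one_mulVec]

lemma leastSquares_apply (X : Matrix (Fin n) (Fin p) ℝ) (y : Fin n → ℝ) (j : Fin p) :
    leastSquares X y j = ∑ i, ((Xᵀ * X)⁻¹ * Xᵀ) j i * y i := by
  unfold leastSquares
  rw [Matrix.mulVec_mulVec]
  rfl

lemma sum_sq_leastSquares_weights {X : Matrix (Fin n) (Fin p) ℝ} (hX : IsUnit (Xᵀ * X))
    (j : Fin p) : ∑ i, ((Xᵀ * X)⁻¹ * Xᵀ) j i ^ 2 = (Xᵀ * X)⁻¹ j j := by
  have h : ((Xᵀ * X)⁻¹ * Xᵀ) * ((Xᵀ * X)⁻¹ * Xᵀ)ᵀ = (Xᵀ * X)⁻¹ := by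
    rw [Matrix.transpose_mul, Matrix.transpose_nonsing_inv, Matrix.transpose_mul,
      Matrix.transpose_transpose, Matrix.mul_assoc, ← Matrix.mul_assoc Xᵀ,
      Matrix.mul_nonsing_inv _ ((Matrix.isUnit_iff_isUnit_det _).1 hX), Matrix.mul_one]
  calc _ = (((Xᵀ * X)⁻¹ * Xᵀ) * ((Xᵀ * X)⁻¹ * Xᵀ)ᵀ) j j := by
        rw [Matrix.mul_apply]
        exact Finset.sum_congr rfl fun i _ => by rw [Matrix.transpose_apply, sq]
    _ = _ := by rw [h]

lemma mem_region_iff {X : Matrix (Fin n) (Fin p) ℝ} {lam : Fin p → ℝ}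
    (hr : 0 < √(lamStar lam / n)) (A : Set (Fin p → ℝ)) (y : Fin n → ℝ) (β : Fin p → ℝ) :
    β ∈ region X lam A y ↔ (√(lamStar lam / n))⁻¹ • (estimator X lam y - β) ∈ A := by
  unfold region
  generalize √(lamStar lam / n) = r at hr ⊢
  constructor
  · rintro ⟨a, ha, rfl⟩
    simpa [smul_smul, hr.ne'] using ha
  · exact fun h => ⟨_, h, by simp [smul_smul, hr.ne']⟩

variable [MeasurableSpace Ω] {P : Measure Ω}

lemma measure_le_abs_weightedSum_le [IsProbabilityMeasure P] {ε : Fin n → Ω → ℝ}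
    (hindep : iIndepFun ε P) (hL2 : ∀ i, MemLp (ε i) 2 P) (hmean : ∀ i, ∫ ω, ε i ω ∂P = 0) {s : ℝ}
    (hs : ∀ i, variance (ε i) P = s) (a : Fin n → ℝ) {η : ℝ} (hη : 0 < η) :
    P {ω | η ≤ |∑ i, a i * ε i ω|} ≤ ENNReal.ofReal (s * (∑ i, a i ^ 2) / η ^ 2) := by
  have hL2' : ∀ i, MemLp (fun ω => a i * ε i ω) 2 P := fun i => (hL2 i).const_mul _
  have hfun : (∑ i, fun ω => a i * ε i ω) = fun ω => ∑ i, a i * ε i ω := by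
    ext ω; simp
  have hvar : variance (fun ω => ∑ i, a i * ε i ω) P = s * ∑ i, a i ^ 2 := by
    rw [← hfun, IndepFun.variance_sum (fun i _ => hL2' i), Finset.mul_sum]
    · refine Finset.sum_congr rfl fun i _ => ?_
      rw [variance_const_mul, hs, mul_comm]
    · intro i _ k _ hik
      exact (hindep.indepFun hik).comp (measurable_const_mul (a i)) (measurable_const_mul (a k))
  have hint : ∫ ω, ∑ i, a i * ε i ω ∂P = 0 := by
    rw [integral_finsetSum _ fun i _ => (hL2' i).integrable one_le_two]
    exact Finset.sum_eq_zero fun i _ => by rw [integral_const_mul, hmean, mul_zero]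
  have h := meas_ge_le_variance_div_sq (memLp_finsetSum _ fun i _ => hL2' i) hη
    (X := fun ω => ∑ i, a i * ε i ω)
  simpa only [hint, sub_zero, hvar] using h

/-- An atom of the error law would make all errors coincide with positive probability, and then the
least-squares estimator vanishes for a suitable parameter. -/
lemma measure_singleton_eq_zero_of_leastSquares_ne_zero {X : Matrix (Fin n) (Fin p) ℝ}
    (hX : IsUnit (Xᵀ * X)) {ε : Fin n → Ω → ℝ} (hindep : iIndepFun ε P)
    (hmeas : ∀ i, AEMeasurable (ε i) P) {μ : Measure ℝ} (hlaw : ∀ i, P.map (ε i) = μ) (j : Fin p)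
    (hLS : ∀ β : Fin p → ℝ, P {ω | leastSquares X (response X ε β ω) j = 0} = 0) (x : ℝ) :
    μ {x} = 0 := by
  set z := leastSquares X (fun _ => x) with hz
  have hzero : P (⋂ i ∈ Finset.univ, ε i ⁻¹' {x}) = 0 := by
    refine measure_mono_null (fun ω hω => ?_) (hLS (-z))
    have hω' : (fun i => ε i ω) = fun _ => x := by
      ext i
      simpa using Set.mem_iInter₂.1 hω i (Finset.mem_univ i)
    rw [Set.mem_ofPred_eq, leastSquares_response hX, hω', ← hz]
    simp
  rw [hindep.measure_inter_preimage_eq_mul _ fun i _ => measurableSet_singleton x,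
    Finset.prod_eq_zero_iff] at hzero
  obtain ⟨i, -, hi⟩ := hzero
  rwa [← hlaw i, Measure.map_apply_of_aemeasurable (hmeas i) (measurableSet_singleton x)]

end LeastSquares

section Asymptotics

variable {Ω : Type*} [MeasurableSpace Ω] {P : Measure Ω} [IsProbabilityMeasure P] {p : ℕ}
  {X : (n : ℕ) → Matrix (Fin n) (Fin p) ℝ} {C : Matrix (Fin p) (Fin p) ℝ}

lemma eventually_isUnit_gram (hC : C.PosDef)
    (hX : Tendsto (fun n : ℕ => (n : ℝ)⁻¹ • ((X n)ᵀ * X n)) atTop (𝓝 C)) :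
    ∀ᶠ n in atTop, IsUnit ((X n)ᵀ * X n) := by
  have hdet : Tendsto (fun n : ℕ => ((n : ℝ)⁻¹ • ((X n)ᵀ * X n)).det) atTop (𝓝 C.det) :=
    ((continuous_id.matrix_det).tendsto C).comp hX
  filter_upwards [hdet.eventually_ne hC.det_pos.ne'] with n hn
  rw [Matrix.det_smul] at hn
  rw [Matrix.isUnit_iff_isUnit_det]
  exact (right_ne_zero_of_mul hn).isUnit

lemma tendsto_natCast_mul_inv_gram (hC : C.PosDef)
    (hX : Tendsto (fun n : ℕ => (n : ℝ)⁻¹ • ((X n)ᵀ * X n)) atTop (𝓝 C)) (j : Fin p) :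
    Tendsto (fun n : ℕ => (n : ℝ) * ((X n)ᵀ * X n)⁻¹ j j) atTop (𝓝 (C⁻¹ j j)) := by
  have hinv : Tendsto (fun n : ℕ => ((n : ℝ)⁻¹ • ((X n)ᵀ * X n))⁻¹) atTop (𝓝 C⁻¹) := by
    have hdet : Tendsto (fun n : ℕ => ((n : ℝ)⁻¹ • ((X n)ᵀ * X n)).det) atTop (𝓝 C.det) :=
      ((continuous_id.matrix_det).tendsto C).comp hX
    have hadj : Tendsto (fun n : ℕ => ((n : ℝ)⁻¹ • ((X n)ᵀ * X n)).adjugate) atTop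
        (𝓝 C.adjugate) := ((continuous_id.matrix_adjugate).tendsto C).comp hX
    simp only [Matrix.inv_def, Ring.inverse_eq_inv']
    exact (hdet.inv₀ hC.det_pos.ne').smul hadj
  have hjj := tendsto_pi_nhds.1 (tendsto_pi_nhds.1 hinv j) j
  refine hjj.congr' ?_
  filter_upwards [eventually_isUnit_gram hC hX, eventually_gt_atTop 0] with n hn hn0
  have hn0' : (n : ℝ) ≠ 0 := by exact_mod_cast hn0.ne'
  have : ((n : ℝ)⁻¹ • ((X n)ᵀ * X n))⁻¹ = (n : ℝ) • ((X n)ᵀ * X n)⁻¹ := by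
    refine Matrix.inv_eq_right_inv ?_
    rw [Matrix.smul_mul, Matrix.mul_smul, smul_smul, inv_mul_cancel₀ hn0', one_smul,
      Matrix.mul_nonsing_inv _ ((Matrix.isUnit_iff_isUnit_det _).1 hn)]
  rw [this]
  rfl

variable {ε : (n : ℕ) → Fin n → Ω → ℝ}

/-- The least-squares error is of order `n^(-1/2)`, hence negligible relative to `√(Λ/n)`. -/
lemma tendsto_measure_scaled_leastSquares (hindep : ∀ n, iIndepFun (ε n) P)
    (hL2 : ∀ n i, MemLp (ε n i) 2 P) (hmean : ∀ n i, ∫ ω, ε n i ω ∂P = 0) {s : ℝ}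
    (hs : ∀ n i, variance (ε n i) P = s) (hC : C.PosDef)
    (hX : Tendsto (fun n : ℕ => (n : ℝ)⁻¹ • ((X n)ᵀ * X n)) atTop (𝓝 C))
    {Λ : ℕ → ℝ} (hΛ : Tendsto Λ atTop atTop) {η : ℝ} (hη : 0 < η) (j : Fin p) :
    Tendsto (fun n : ℕ => P {ω | η < |(√(Λ n / n))⁻¹ * leastSquares (X n) (fun i => ε n i ω) j|})
      atTop (𝓝 0) := by
  have hlim : Tendsto (fun n : ℕ => ENNReal.ofReal
      (s * ((n : ℝ) * ((X n)ᵀ * X n)⁻¹ j j) / η ^ 2 * (Λ n)⁻¹)) atTop (𝓝 0) := by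
    rw [← ENNReal.ofReal_zero]
    refine ENNReal.tendsto_ofReal ?_
    have h := (((tendsto_natCast_mul_inv_gram hC hX j).const_mul s).div_const (η ^ 2)).mul
      hΛ.inv_tendsto_atTop
    rwa [mul_zero] at h
  refine tendsto_of_tendsto_of_tendsto_of_le_of_le' tendsto_const_nhds hlim
    (Eventually.of_forall fun _ => zero_le) ?_
  filter_upwards [eventually_isUnit_gram hC hX, eventually_gt_atTop 0,
    hΛ.eventually_gt_atTop 0] with n hn hn0 hΛ0
  have hn0' : (0 : ℝ) < n := by exact_mod_cast hn0
  have hr : 0 < √(Λ n / n) := Real.sqrt_pos.2 (by positivity)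
  have hsub : {ω | η < |(√(Λ n / n))⁻¹ * leastSquares (X n) (fun i => ε n i ω) j|} ⊆
      {ω | η * √(Λ n / n) ≤ |∑ i, (((X n)ᵀ * X n)⁻¹ * (X n)ᵀ) j i * ε n i ω|} := by
    intro ω hω
    rw [Set.mem_ofPred_eq, abs_mul, abs_of_pos (inv_pos.2 hr), leastSquares_apply,
      inv_mul_eq_div, lt_div_iff₀ hr] at hω
    exact hω.le
  refine (measure_mono hsub).trans ((measure_le_abs_weightedSum_le (hindep n) (hL2 n) (hmean n)
    (hs n) _ (by positivity)).trans (le_of_eq ?_))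
  rw [sum_sq_leastSquares_weights hn, mul_pow, Real.sq_sqrt (by positivity)]
  congr 1
  field_simp

/-- Anti-concentration of the least-squares estimator at scale `n^(-1/2)`, uniformly over the
location. -/
lemma tendsto_iSup_measure_leastSquares_lt (hindep : ∀ n, iIndepFun (ε n) P)
    {μ : Measure ℝ} [IsProbabilityMeasure μ] (hL2 : MemLp id 2 μ) (hmean : ∫ x, x ∂μ = 0)
    (hμ : ∀ x, μ {x} = 0) (hmeas : ∀ n i, AEMeasurable (ε n i) P)
    (hlaw : ∀ n i, P.map (ε n i) = μ) (hC : C.PosDef)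
    (hX : Tendsto (fun n : ℕ => (n : ℝ)⁻¹ • ((X n)ᵀ * X n)) atTop (𝓝 C))
    {κ : ℕ → ℝ} (hκ : Tendsto κ atTop (𝓝 0)) (j : Fin p) :
    Tendsto (fun n : ℕ => ⨆ x : ℝ,
      P {ω | |√n * leastSquares (X n) (fun i => ε n i ω) j - x| < κ n}) atTop (𝓝 0) := by
  have hc : 0 < C⁻¹ j j := hC.inv.diag_pos
  rw [ENNReal.tendsto_nhds_zero]
  intro τ' hτ'
  obtain ⟨τ, hτ0, hτle⟩ : ∃ τ : ℝ, 0 < τ ∧ ENNReal.ofReal τ ≤ τ' := by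
    obtain ⟨τ, -, h1, h2⟩ := ENNReal.lt_iff_exists_real_btwn.1 hτ'
    exact ⟨τ, ENNReal.ofReal_pos.1 h1, h2.le⟩
  obtain ⟨δ, hδ, hle⟩ := exists_measureReal_weightedSum_le μ hL2 hmean hμ P hτ0 (half_pos hc)
  filter_upwards [eventually_isUnit_gram hC hX, hκ.eventually_lt_const hδ,
    (tendsto_natCast_mul_inv_gram hC hX j).eventually_const_lt (half_lt_self hc)] with n hn hκn hjj
  refine iSup_le fun x => le_trans ?_ hτle
  have h := hle n (ε n) (hindep n) (hmeas n) (hlaw n)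
    (fun i => √n * (((X n)ᵀ * X n)⁻¹ * (X n)ᵀ) j i) (by
      simp only [mul_pow]
      rw [← Finset.mul_sum, sum_sq_leastSquares_weights hn, Real.sq_sqrt (Nat.cast_nonneg n)]
      exact hjj.le) x
  rw [← ofReal_measureReal]
  refine ENNReal.ofReal_le_ofReal (le_trans (measureReal_mono fun ω hω => ?_) h)
  rw [Set.mem_ofPred_eq, leastSquares_apply, Finset.mul_sum] at hω
  rw [Set.mem_ofPred_eq]
  simp only [mul_assoc]
  exact hω.trans hκn

end Asymptotics

/-! ### Tuning parameters -/

section Tuning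

variable {p : ℕ} {lam : ℕ → Fin p → ℝ}

lemma tendsto_div_sqrt_of_tendsto_top (hlam : ∀ n j, 0 ≤ lam n j)
    (hlam_top : Tendsto (fun n => lamStar (lam n)) atTop atTop) {j : Fin p}
    (hψ : Tendsto (fun n => ENNReal.ofReal (√(lamStar (lam n))) / ENNReal.ofReal (lam n j))
      atTop (𝓝 ∞)) :
    Tendsto (fun n => lam n j / √(lamStar (lam n))) atTop (𝓝 0) := by
  have h1 := tendsto_inv_iff.2 hψ
  rw [ENNReal.inv_top] at h1
  have h2 := (ENNReal.tendsto_toReal ENNReal.zero_ne_top).comp h1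
  rw [ENNReal.toReal_zero] at h2
  refine h2.congr' ?_
  filter_upwards [hlam_top.eventually_gt_atTop 0] with n hn
  have hs : 0 < √(lamStar (lam n)) := Real.sqrt_pos.2 hn
  rw [Function.comp_apply, ENNReal.toReal_inv, ENNReal.toReal_div,
    ENNReal.toReal_ofReal hs.le, ENNReal.toReal_ofReal (hlam n j), inv_div]

/-- The largest tuning parameter is attained, so some limiting ratio equals one. -/
lemma exists_lam0_eq_one (hlam_top : Tendsto (fun n => lamStar (lam n)) atTop atTop)
    {lam0 : Fin p → ℝ}
    (hlam0 : ∀ j, Tendsto (fun n => lam n j / lamStar (lam n)) atTop (𝓝 (lam0 j))) :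
    ∃ j, lam0 j = 1 := by
  by_contra! hne
  have hall : ∀ᶠ n in atTop, ∀ j, lam n j / lamStar (lam n) ≠ 1 :=
    eventually_all.2 fun j => (hlam0 j).eventually_ne (hne j)
  obtain ⟨n, hn, hpos⟩ := (hall.and (hlam_top.eventually_gt_atTop 0)).exists
  have : Nonempty (Fin p) := by
    by_contra hempty
    rw [not_nonempty_iff] at hempty
    simp [lamStar] at hpos
  obtain ⟨j, hj⟩ := exists_eq_ciSup_of_finite (f := lam n)
  refine hn j ?_
  rw [hj]
  exact div_self hpos.ne'

lemma psi_lt_top_of_lam0_eq_one (hlam : ∀ n j, 0 ≤ lam n j)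
    (hlam_top : Tendsto (fun n => lamStar (lam n)) atTop atTop) {j : Fin p} {ψ : ℝ≥0∞}
    (hlam0 : Tendsto (fun n => lam n j / lamStar (lam n)) atTop (𝓝 1))
    (hψ : Tendsto (fun n => ENNReal.ofReal (√(lamStar (lam n))) / ENNReal.ofReal (lam n j))
      atTop (𝓝 ψ)) : ψ < ∞ := by
  rw [lt_top_iff_ne_top]
  rintro rfl
  have h1 := tendsto_div_sqrt_of_tendsto_top hlam hlam_top hψ
  have h2 := hlam0.pos_mul_atTop one_pos (Real.tendsto_sqrt_atTop.comp hlam_top)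
  refine not_tendsto_nhds_of_tendsto_atTop h2 0 (h1.congr' ?_)
  filter_upwards [hlam_top.eventually_gt_atTop 0] with n hn
  have hs : 0 < √(lamStar (lam n)) := Real.sqrt_pos.2 hn
  rw [Function.comp_apply]
  nth_rewrite 2 [← Real.sq_sqrt hn.le]
  field_simp

end Tuning

/-! ### Coverage probabilities -/

section Coverage

variable {n p : ℕ} {X : Matrix (Fin n) (Fin p) ℝ} {Ω : Type*}

/-- The rescaled estimation error splits into the deviation from least squares and the rescaled
least-squares error. -/
lemma smul_estimator_sub_eq (hX : IsUnit (Xᵀ * X)) (lam : Fin p → ℝ) (ε : Fin n → Ω → ℝ)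
    (β : Fin p → ℝ) (ω : Ω) (c : ℝ) :
    c • (estimator X lam (response X ε β ω) - β) =
      c • (estimator X lam (response X ε β ω) - leastSquares X (response X ε β ω)) +
        c • leastSquares X (fun i => ε i ω) := by
  rw [← smul_add, leastSquares_response hX ε β ω]
  congr 1
  abel

/-- Lower bound for the coverage at a fixed sample size, uniform in the parameter: the region
covers unless the scaled least-squares error exceeds `η`, or some component with `ψⱼ = ∞` has its
least-squares estimate too close to zero. -/
lemma one_le_coverage_add [MeasurableSpace Ω] {P : Measure Ω} [IsProbabilityMeasure P]
    (hX : IsUnit (Xᵀ * X)) (hn : 0 < n) {lam : Fin p → ℝ} (hlam : ∀ j, 0 ≤ lam j)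
    (hΛ : 0 < lamStar lam) (ε : Fin n → Ω → ℝ) (ψ : Fin p → ℝ≥0∞) {O : Set (Fin p → ℝ)} {η : ℝ}
    (hη : 0 < η)
    (hmem : ∀ v e : Fin p → ℝ,
      (∀ j, v j * (((n : ℝ)⁻¹ • (Xᵀ * X)) *ᵥ v) j ≤ lam j / lamStar lam) →
      (∀ j, ψ j = ∞ → |(((n : ℝ)⁻¹ • (Xᵀ * X)) *ᵥ v) j| ≤ η) → (∀ j, |e j| ≤ η) → v + e ∈ O)
    (β : Fin p → ℝ) :
    1 ≤ coverage P X ε lam O β +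
      (∑ j, P {ω | η < |(√(lamStar lam / n))⁻¹ * leastSquares X (fun i => ε i ω) j|} +
        ∑ j, if ψ j = ∞ then ⨆ x : ℝ, P {ω | |√n * leastSquares X (fun i => ε i ω) j - x| <
          lam j / √(lamStar lam) / η} else 0) := by
  have hn' : (0 : ℝ) < n := by exact_mod_cast hn
  have hr : 0 < √(lamStar lam / n) := Real.sqrt_pos.2 (by positivity)
  set r := √(lamStar lam / n) with hrdef
  have hrn : r * √n = √(lamStar lam) := by
    rw [hrdef, Real.sqrt_div hΛ.le, div_mul_cancel₀ _ (Real.sqrt_pos.2 hn').ne']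
  set B₁ : Fin p → Set Ω := fun j => {ω | η < |r⁻¹ * leastSquares X (fun i => ε i ω) j|} with hB₁
  set B₂ : Fin p → Set Ω := fun j => if ψ j = ∞ then
    {ω | |√n * leastSquares X (fun i => ε i ω) j - -(√n * β j)| < lam j / √(lamStar lam) / η}
    else ∅ with hB₂
  have hcover : Set.univ ⊆ {ω | β ∈ region X lam O (response X ε β ω)} ∪
      ((⋃ j, B₁ j) ∪ ⋃ j, B₂ j) := by
    intro ω _
    by_contra hω
    simp only [Set.mem_union, Set.mem_iUnion, not_or, not_exists] at hω
    obtain ⟨h0, h1, h2⟩ := hω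
    refine h0 ?_
    rw [Set.mem_ofPred_eq, mem_region_iff hr, smul_estimator_sub_eq hX]
    have hkkt := scaled_subgradient X hX lam hlam (response X ε β ω) hΛ hn rfl
    refine hmem _ _ (fun j => (hkkt j).2.1) (fun j hj => ?_) fun j => not_lt.1 (h1 j)
    by_contra! hlt
    refine h2 j ?_
    simp only [hB₂, if_pos hj]
    rw [Set.mem_ofPred_eq, sub_neg_eq_add, ← mul_add, add_comm, ← Pi.add_apply,
      ← leastSquares_response hX ε β ω]
    have h3 := hlt.trans_le (hkkt j).1
    rw [← hrdef] at h3
    -- a vanishing least-squares component carries no penalty, as `x / 0 = 0`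
    have hL : 0 < |leastSquares X (response X ε β ω) j| := by
      refine (abs_nonneg _).lt_of_ne' fun h4 => ?_
      rw [h4, div_zero, mul_zero] at h3
      exact absurd h3 hη.not_gt
    rw [abs_mul, abs_of_nonneg (Real.sqrt_nonneg _), lt_div_iff₀ hη]
    rw [← mul_div_assoc, lt_div_iff₀ hL] at h3
    have hs : 0 < √(lamStar lam) := Real.sqrt_pos.2 hΛ
    calc √n * |leastSquares X (response X ε β ω) j| * η
        = √n * (η * |leastSquares X (response X ε β ω) j|) := by ring
      _ < √n * (lam j / lamStar lam * r) :=
          mul_lt_mul_of_pos_left h3 (Real.sqrt_pos.2 hn')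
      _ = lam j / lamStar lam * √(lamStar lam) := by rw [← hrn]; ring
      _ = lam j / √(lamStar lam) := by
          rw [div_mul_eq_mul_div, div_eq_div_iff hΛ.ne' hs.ne', mul_assoc,
            Real.mul_self_sqrt hΛ.le]
  calc (1 : ℝ≥0∞) = P Set.univ := measure_univ.symm
    _ ≤ _ := measure_mono hcover
    _ ≤ _ := measure_union_le _ _
    _ ≤ coverage P X ε lam O β + (∑ j, P (B₁ j) + ∑ j, P (B₂ j)) := by
        refine add_le_add le_rfl ((measure_union_le _ _).trans ?_)
        exact add_le_add (measure_iUnion_fintype_le _ _) (measure_iUnion_fintype_le _ _)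
    _ ≤ _ := by
        refine add_le_add le_rfl (add_le_add le_rfl (Finset.sum_le_sum fun j _ => ?_))
        by_cases hj : ψ j = ∞
        · simp only [hB₂, if_pos hj]
          exact le_iSup (fun x : ℝ => P {ω | |√n * leastSquares X (fun i => ε i ω) j - x| <
            lam j / √(lamStar lam) / η}) (-(√n * β j))
        · simp [hB₂, if_neg hj]

/-- Upper bound for the coverage at the critical parameter at a fixed sample size: the region fails
to cover unless the scaled least-squares error exceeds `η`. -/
lemma coverage_le_of_critical [MeasurableSpace Ω] {P : Measure Ω}
    (hX : IsUnit (Xᵀ * X)) (hn : 0 < n) {lam : Fin p → ℝ} (hlam : ∀ j, 0 ≤ lam j)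
    (hΛ : 0 < lamStar lam) (ε : Fin n → Ω → ℝ) {M : Set (Fin p → ℝ)} {η t : ℝ} (j₀ : Fin p)
    (hnot : ∀ v e : Fin p → ℝ,
      (∀ j, v j * (((n : ℝ)⁻¹ • (Xᵀ * X)) *ᵥ v) j ≤ lam j / lamStar lam) →
      (∀ k, k ≠ j₀ → |(((n : ℝ)⁻¹ • (Xᵀ * X)) *ᵥ v) k| ≤
        lam k / lamStar lam * (√(lamStar lam / n) / |1 + √(lamStar lam / n) * e k|)) →
      (((n : ℝ)⁻¹ • (Xᵀ * X)) *ᵥ v) j₀ * (t + (v + e) j₀) =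
        -(lam j₀ / lamStar lam * (1 / |t + e j₀|) * |t + (v + e) j₀|) →
      (∀ j, |e j| ≤ η) → v + e ∉ M) :
    coverage P X ε lam M (fun k => if k = j₀ then √(lamStar lam / n) * t else 1) ≤
      ∑ j, P {ω | η < |(√(lamStar lam / n))⁻¹ * leastSquares X (fun i => ε i ω) j|} := by
  have hn' : (0 : ℝ) < n := by exact_mod_cast hn
  have hr : 0 < √(lamStar lam / n) := Real.sqrt_pos.2 (by positivity)
  set r := √(lamStar lam / n) with hrdef
  set β : Fin p → ℝ := fun k => if k = j₀ then r * t else 1 with hβ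
  have hβ₀ : β j₀ = r * t := if_pos rfl
  have hβ₁ : ∀ k, k ≠ j₀ → β k = 1 := fun k hk => if_neg hk
  refine le_trans (measure_mono fun ω hω => ?_) (measure_iUnion_fintype_le P _)
  by_contra hsmall
  simp only [Set.mem_iUnion, not_exists] at hsmall
  rw [Set.mem_ofPred_eq, mem_region_iff hr, smul_estimator_sub_eq hX] at hω
  have hkkt := scaled_subgradient X hX lam hlam (response X ε β ω) hΛ hn rfl
  rw [← hrdef] at hkkt hω
  have hsum := smul_estimator_sub_eq hX lam ε β ω r⁻¹
  set v := r⁻¹ • (estimator X lam (response X ε β ω) - leastSquares X (response X ε β ω)) with hv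
  set e := r⁻¹ • leastSquares X (fun i => ε i ω) with he
  have hL : ∀ k, leastSquares X (response X ε β ω) k = β k + r * e k := by
    intro k
    rw [leastSquares_response hX, he, Pi.add_apply, Pi.smul_apply, smul_eq_mul,
      mul_inv_cancel_left₀ hr.ne']
  have hb : estimator X lam (response X ε β ω) j₀ = r * (t + (v + e) j₀) := by
    rw [← hsum, Pi.smul_apply, Pi.sub_apply, smul_eq_mul, mul_add, mul_inv_cancel_left₀ hr.ne', hβ₀]
    ring
  refine hnot v e (fun j => (hkkt j).2.1) (fun k hk => ?_) ?_ (fun j => not_lt.1 (hsmall j)) hω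
  · have h := (hkkt k).1
    rwa [hL, hβ₁ k hk] at h
  · have h := (hkkt j₀).2.2
    rw [hL, hb, hβ₀, ← mul_add, abs_mul, abs_mul, abs_of_pos hr] at h
    have h1 : r / (r * |t + e j₀|) = 1 / |t + e j₀| := by
      rw [← div_div, div_self hr.ne']
    rw [h1] at h
    refine mul_left_cancel₀ hr.ne' ?_
    linear_combination h

end Coverage

end AdaptiveLasso

theorem theorem5 {Ω : Type*} [MeasurableSpace Ω] (P : Measure Ω) [IsProbabilityMeasure P]
    {p : ℕ}
    -- for each sample size `n`: regressor matrix, error vector and tuning parameters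
    (X : (n : ℕ) → Matrix (Fin n) (Fin p) ℝ)
    (ε : (n : ℕ) → Fin n → Ω → ℝ)
    (lam : ℕ → Fin p → ℝ)
    -- the errors are i.i.d. with mean zero and finite second moment
    (hindep : ∀ n, iIndepFun (ε n) P)
    (hident : ∀ n i n' i', IdentDistrib (ε n i) (ε n' i') P P)
    (hL2 : ∀ n i, MemLp (ε n i) 2 P)
    (hmean : ∀ n i, ∫ ω, ε n i ω ∂P = 0)
    -- `X'X/n` converges to a positive definite matrix
    (C : Matrix (Fin p) (Fin p) ℝ) (hC : C.PosDef)
    (hX : Tendsto (fun n : ℕ => (n : ℝ)⁻¹ • ((X n)ᵀ * X n)) atTop (𝓝 C))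
    -- no component of the least-squares estimator vanishes with positive probability
    (hLS : ∀ᶠ n in atTop, ∀ (β : Fin p → ℝ) (j : Fin p),
      P {ω | AdaptiveLasso.leastSquares (X n) (AdaptiveLasso.response (X n) (ε n) β ω) j = 0} = 0)
    -- tuning parameters and their asymptotic regime
    (hlam : ∀ n j, 0 ≤ lam n j)
    (lam0 : Fin p → ℝ) (ψ : Fin p → ℝ≥0∞)
    (hlam0 : ∀ j, Tendsto (fun n => lam n j / AdaptiveLasso.lamStar (lam n)) atTop (𝓝 (lam0 j)))
    (hψ : ∀ j, Tendsto
      (fun n => ENNReal.ofReal (Real.sqrt (AdaptiveLasso.lamStar (lam n))) /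
        ENNReal.ofReal (lam n j)) atTop (𝓝 (ψ j)))
    (hlam_n : Tendsto (fun n : ℕ => AdaptiveLasso.lamStar (lam n) / n) atTop (𝓝 0))
    (hlam_top : Tendsto (fun n => AdaptiveLasso.lamStar (lam n)) atTop atTop) :
    (∀ O : Set (Fin p → ℝ), IsOpen O → AdaptiveLasso.minimizerSet C lam0 ψ ⊆ O →
      Tendsto (fun n => ⨅ β : Fin p → ℝ, AdaptiveLasso.coverage P (X n) (ε n) (lam n) O β)
        atTop (𝓝 1)) ∧
    (∀ d : ℝ, 0 < d → d < 1 →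
      Tendsto (fun n => ⨅ β : Fin p → ℝ, AdaptiveLasso.coverage P (X n) (ε n) (lam n)
        (AdaptiveLasso.minimizerSet C (d • lam0) ψ) β) atTop (𝓝 0)) := by
  obtain ⟨j₀, hj₀⟩ := AdaptiveLasso.exists_lam0_eq_one hlam_top hlam0
  have hunit := AdaptiveLasso.eventually_isUnit_gram hC hX
  have hmeas : ∀ n i, AEMeasurable (ε n i) P := fun n i => (hL2 n i).aemeasurable
  -- the common error law, and its lack of atoms
  set μ := P.map (ε 1 0) with hμ
  have hlaw : ∀ n i, P.map (ε n i) = μ := fun n i => (hident n i 1 0).map_eq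
  have : IsProbabilityMeasure μ := Measure.isProbabilityMeasure_map (hmeas 1 0)
  have hatom : ∀ x, μ {x} = 0 := by
    obtain ⟨n, hn, hn'⟩ := (hunit.and hLS).exists
    exact AdaptiveLasso.measure_singleton_eq_zero_of_leastSquares_ne_zero hn (hindep n) (hmeas n)
      (hlaw n) j₀ fun β => hn' β j₀
  have hμ2 : MemLp id 2 μ :=
    (memLp_map_measure_iff aestronglyMeasurable_id (hmeas 1 0)).2 (hL2 1 0)
  have hμ0 : ∫ x, x ∂μ = 0 := by
    rw [hμ, integral_map (f := fun x : ℝ => x) (hmeas 1 0) (by fun_prop)]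
    exact hmean 1 0
  have htail : ∀ η > 0, Tendsto (fun n : ℕ => ∑ j, P {ω | η <
      |(√(AdaptiveLasso.lamStar (lam n) / n))⁻¹ *
        AdaptiveLasso.leastSquares (X n) (fun i => ε n i ω) j|}) atTop (𝓝 0) := by
    intro η hη
    simpa using tendsto_finsetSum Finset.univ fun j _ =>
      AdaptiveLasso.tendsto_measure_scaled_leastSquares hindep hL2 hmean
        (fun n i => (hident n i 1 0).variance_eq) hC hX hlam_top hη j
  refine ⟨fun O hO hMO => ?_, fun d _ hd => ?_⟩
  · obtain ⟨η, hη, hmem⟩ :=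
      AdaptiveLasso.exists_pos_eventually_mem_of_isOpen hC hX hlam0 ψ hO hMO
    have hanti : Tendsto (fun n : ℕ => ∑ j, if ψ j = ∞ then ⨆ x : ℝ,
        P {ω | |√n * AdaptiveLasso.leastSquares (X n) (fun i => ε n i ω) j - x| <
          lam n j / √(AdaptiveLasso.lamStar (lam n)) / η} else 0) atTop (𝓝 0) := by
      rw [show 𝓝 (0 : ℝ≥0∞) = 𝓝 (∑ _j : Fin p, 0) by rw [Finset.sum_const_zero]]
      refine tendsto_finsetSum _ fun j _ => ?_
      by_cases hj : ψ j = ∞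
      · simp only [if_pos hj]
        have hκ := (AdaptiveLasso.tendsto_div_sqrt_of_tendsto_top hlam hlam_top
          (hj ▸ hψ j)).div_const η
        rw [zero_div] at hκ
        exact AdaptiveLasso.tendsto_iSup_measure_leastSquares_lt hindep hμ2 hμ0 hatom hmeas hlaw
          hC hX hκ j
      · simp only [if_neg hj]
        exact tendsto_const_nhds
    have hbad := (htail η hη).add hanti
    rw [add_zero] at hbad
    have hlow := ENNReal.Tendsto.sub (tendsto_const_nhds (x := (1 : ℝ≥0∞))) hbad
      (Or.inl ENNReal.one_ne_top)
    rw [tsub_zero] at hlow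
    refine tendsto_of_tendsto_of_tendsto_of_le_of_le' hlow tendsto_const_nhds ?_
      (Eventually.of_forall fun n => (iInf_le _ 0).trans prob_le_one)
    filter_upwards [hunit, hmem, eventually_gt_atTop 0, hlam_top.eventually_gt_atTop 0]
      with n hn hmemn hn0 hΛ
    exact le_iInf fun β => tsub_le_iff_right.2
      (AdaptiveLasso.one_le_coverage_add hn hn0 (hlam n) hΛ (ε n) ψ hη hmemn β)
  · have hq : 0 < C⁻¹ j₀ j₀ := hC.inv.diag_pos
    have hr : Tendsto (fun n : ℕ => √(AdaptiveLasso.lamStar (lam n) / n)) atTop (𝓝 0) := by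
      simpa using hlam_n.sqrt
    obtain ⟨η, hη, hnot⟩ := AdaptiveLasso.exists_pos_eventually_notMem hC hX hlam0 ψ hr hj₀
      (AdaptiveLasso.psi_lt_top_of_lam0_eq_one hlam hlam_top (hj₀ ▸ hlam0 j₀) (hψ j₀)) hd
      (Real.sqrt_pos.2 hq) (Real.sq_sqrt hq.le)
    refine tendsto_of_tendsto_of_tendsto_of_le_of_le' tendsto_const_nhds (htail η hη)
      (Eventually.of_forall fun _ => zero_le) ?_
    filter_upwards [hunit, hnot, eventually_gt_atTop 0, hlam_top.eventually_gt_atTop 0]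
      with n hn hnotn hn0 hΛ
    exact (iInf_le _ _).trans
      (AdaptiveLasso.coverage_le_of_critical hn hn0 (hlam n) hΛ (ε n) j₀ hnotn)
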